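/- **Setting.** Let $n\in\mathbb N$ and let $\mathbb H^n$ be the Heisenberg group: $\mathbb R^{2n+1}$ with points $(x,y,t)$, group law $(x,y,t)\circ(\tilde x,\tilde y,\tilde t)=(x+\tilde x,\,y+\tilde y,\,t+\tilde t+2\sum_{i}(\tilde x_iy_i-x_i\tilde y_i))$ and Lebesgue measure. Let $X_i=\partial_{x_i}+2y_i\partial_t$, $Y_i=\partial_{y_i}-2x_i\partial_t$, $\nabla_H=(X_1,\dots,X_n,Y_1,\dots,Y_n)$ and $\mathcal L=\sum_i(X_i^2+Y_i^2)$. Let $H^1_{\mathcal L}(\mathbb H^n)$ be the space of complex-valued $u\in L^2$ whose weak horizontal gradient $\nabla_Hu$ lies in $L^2$, with norm $(\|u\|^2+\|\nabla_Hu\|^2)^{1/2}$, and let $H^{-1}_{\mathcal L}$ be its dual; $\|\cdot\|$ is the $L^2$ norm and $(\cdot,\cdot)$ the $L^2$ inner product. Let $b,m>0$. Let $g:[0,\infty)\to\mathbb R$ be $C^1$ and put $F(z)=g(|z|)$ and $f(z)=g'(|z|)z/|z|$ for $z\in\mathbb C\setminus\{0\}$, $F(0)=g(0)$, $f(0)=0$.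 Consider $$u_{tt}-\mathcal Lu+bu_t+mu=f(u),\qquad u(0)=u_0\in H^1_{\mathcal L}(\mathbb H^n),\quad u_t(0)=u_1\in L^2(\mathbb H^n).\tag{1}$$ For $0<T\le\infty$, a *weak solution* of (1) on $[0,T)$ is a function $u\in C([0,T);H^1_{\mathcal L})\cap C^1([0,T);L^2)$ with $u_t\in L^2_{loc}([0,T);H^1_{\mathcal L})$, $u_{tt}\in L^2_{loc}([0,T);H^{-1}_{\mathcal L})$, $u(0)=u_0$, $u_t(0)=u_1$, such that for a.e. $t\in[0,T)$ and all $v\in H^1_{\mathcal L}$ $$\mathrm{Re}\langle u_{tt},v\rangle+\mathrm{Re}\int\nabla_Hu\cdot\nabla_Hv\,dx+m\,\mathrm{Re}\int uv\,dx+b\,\mathrm{Re}\int u_tv\,dx=\mathrm{Re}\int f(u)v\,dx .$$ Here the nonlinear term is required to be in $L^2_{loc}([0,T);H^{-1}_{\mathcal L})$ through absolutely convergent integrals: for every $0<S<T$ there is $K\in L^2(0,S)$ with $\int|f(u(t))v|\,dx\le K(t)\|v\|_{H^1_{\mathcal L}}$ for a.e. $t\in[0,S]$ and all $v\in H^1_{\mathcal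 L}$. ($L^2_{loc}([0,T))$ means $L^2(0,S)$ for every finite $S<T$.) A weak solution on $[0,T^*)$, $T^*<\infty$, *blows up at time* $T^*$ if $T^*$ is its maximal existence time, i.e. if no weak solution on a longer interval $[0,T')$, $T^*<T'\le\infty$, coincides with it on $[0,T^*)$. **Theorem.** Let $\mu=\max\{b,m,\alpha\}$ and assume that, for some $\alpha>2$, $\alpha F(z)\le\mathrm{Re}[f(z)\bar z]$ for all $z\in\mathbb C$. Let $u_0\in H^1_{\mathcal L}(\mathbb H^n)$ with $F(u_0)\in L^1(\mathbb H^n)$ and $u_1\in L^2(\mathbb H^n)$ satisfy $$I(u_0)=m\|u_0\|^2+\|\nabla_Hu_0\|^2-\mathrm{Re}\int f(u_0)\overline{u_0}\,dx<0,\qquad \mathrm{Re}(u_0,u_1)\ge\frac{\alpha(\mu+1)}{m(\alpha-2)}E(0),$$ where $$E(0)=\tfrac12\|u_1\|^2+\tfrac m2\|u_0\|^2+\tfrac12\|\nabla_Hu_0\|^2-\int F(u_0)\,dx$$ is allowed to be an arbitrary real number, in particular any positive one. Let $u$ be any weak solution of (1) on an interval $[0,T_1)$, $0<T_1\le\infty$.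 Then $u$ blows up in finite time: there are $T^*$ with $0<T^*<\infty$, $T_1\le T^*$, and a weak solution of (1) on $[0,T^*)$ that coincides with $u$ on $[0,T_1)$ and blows up at time $T^*$. (In particular there is no weak solution on $[0,\infty)$, and every weak solution that is not continuable has a finite existence time.) Moreover, if $\mathrm{Re}(u_0,u_1)>0$ (as is the case when $E(0)>0$), then for every $T_0<\infty$ with $T^*\in(0,T_0)$ $$0<T^*\le\frac{2(\mu+1)(bT_0+1)}{(\alpha-2)(\mu+1-m)}\,\frac{\|u_0\|^2}{\mathrm{Re}(u_0,u_1)} .$$ -/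

import Mathlib

open MeasureTheory Set
open scoped ContDiff ComplexConjugate

noncomputable section

/-- The underlying manifold `ℝⁿ × ℝⁿ × ℝ = ℝ²ⁿ⁺¹` of the Heisenberg group, with points `(x, y, t)`.
Its `volume` is the Lebesgue measure, which is the Haar measure of the group law
`(x, y, t) ∘ (x', y', t') = (x + x', y + y', t + t' + 2 ∑ᵢ (x'ᵢ yᵢ - xᵢ y'ᵢ))`. -/
abbrev Heis (n : ℕ) : Type := (Fin n → ℝ) × (Fin n → ℝ) × ℝ

/-- The left-invariant horizontal vector fields: `inl i` is `Xᵢ = ∂/∂xᵢ + 2 yᵢ ∂/∂t` and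
`inr i` is `Yᵢ = ∂/∂yᵢ - 2 xᵢ ∂/∂t`. -/
def horizontalField {n : ℕ} : Fin n ⊕ Fin n → Heis n → Heis n
  | Sum.inl i, p => (Pi.single i 1, 0, 2 * p.2.1 i)
  | Sum.inr i, p => (0, Pi.single i 1, -2 * p.1 i)

/-- The classical derivative of a real test function along a horizontal vector field. -/
def horizontalDeriv {n : ℕ} (j : Fin n ⊕ Fin n) (φ : Heis n → ℝ) (p : Heis n) : ℝ :=
  fderiv ℝ φ p (horizontalField j p)

/-- Complex `L²` on the Heisenberg group. -/
abbrev HeisL2 (n : ℕ) : Type := Lp ℂ 2 (volume : Measure (Heis n))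

/-- `w` is the weak derivative of `u` along the `j`-th horizontal field (these fields are
divergence free, so their formal adjoints are their negatives). -/
def IsWeakHorizontalDeriv {n : ℕ} (j : Fin n ⊕ Fin n) (u w : HeisL2 n) : Prop :=
  ∀ φ : Heis n → ℝ, ContDiff ℝ ∞ φ → HasCompactSupport φ →
    ∫ p, horizontalDeriv j φ p • u p = - ∫ p, φ p • w p

theorem HeisL2.integrable_smul {n : ℕ} (u : HeisL2 n) {ψ : Heis n → ℝ} (hψ : Continuous ψ)
    (hc : HasCompactSupport ψ) : Integrable (fun p => ψ p • u p) :=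
  ((Lp.memLp u).locallyIntegrable (by norm_num)).integrable_smul_left_of_hasCompactSupport hψ hc

theorem continuous_horizontalField {n : ℕ} (j : Fin n ⊕ Fin n) :
    Continuous (horizontalField (n := n) j) := by
  cases j <;> unfold horizontalField <;> fun_prop

theorem continuous_horizontalDeriv {n : ℕ} (j : Fin n ⊕ Fin n) {φ : Heis n → ℝ}
    (hφ : ContDiff ℝ ∞ φ) : Continuous (horizontalDeriv j φ) :=
  (hφ.continuous_fderiv (by simp)).clm_apply (continuous_horizontalField j)

theorem hasCompactSupport_horizontalDeriv {n : ℕ} (j : Fin n ⊕ Fin n) {φ : Heis n → ℝ}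
    (hc : HasCompactSupport φ) : HasCompactSupport (horizontalDeriv j φ) := by
  refine (hc.fderiv (𝕜 := ℝ)).mono fun p hp hp0 => hp ?_
  have h : fderiv ℝ φ p = 0 := hp0
  simp [horizontalDeriv, h]

/-- The sub-Laplacian Sobolev space `H¹` of all `u ∈ L²` whose weak horizontal derivatives are in
`L²`. It is realized as the space of pairs `(u, ∇_H u)`; the inherited norm is
the Hilbert norm `(‖u‖² + ‖∇_H u‖²)^(1/2)`. -/
def sobolevGraph (n : ℕ) :
    Submodule ℂ (WithLp 2 (HeisL2 n × PiLp 2 (fun _ : Fin n ⊕ Fin n => HeisL2 n))) where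
  carrier := {q | ∀ j, IsWeakHorizontalDeriv j q.fst (q.snd j)}
  zero_mem' := by
    intro j φ _ _
    have key : ∀ ψ : Heis n → ℝ, ∫ p, ψ p • (0 : HeisL2 n) p = 0 := by
      intro ψ
      refine integral_eq_zero_of_ae ?_
      filter_upwards [Lp.coeFn_zero ℂ 2 (volume : Measure (Heis n))] with p hp
      rw [hp]
      exact smul_zero (ψ p)
    change ∫ p, horizontalDeriv j φ p • (0 : HeisL2 n) p = - ∫ p, φ p • (0 : HeisL2 n) p
    rw [key, key, neg_zero]
  add_mem' := by
    intro q r hq hr j φ hφ hc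
    have hd := continuous_horizontalDeriv j hφ
    have hdc := hasCompactSupport_horizontalDeriv j hc
    have key : ∀ (ψ : Heis n → ℝ), Continuous ψ → HasCompactSupport ψ → ∀ a b : HeisL2 n,
        ∫ p, ψ p • (a + b : HeisL2 n) p = (∫ p, ψ p • a p) + ∫ p, ψ p • b p := by
      intro ψ hψ hψc a b
      rw [← integral_add (a.integrable_smul hψ hψc) (b.integrable_smul hψ hψc)]
      refine integral_congr_ae ?_
      filter_upwards [Lp.coeFn_add a b] with p hp
      rw [hp, Pi.add_apply, smul_add]
    have e1 := hq j φ hφ hc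
    have e2 := hr j φ hφ hc
    change ∫ p, horizontalDeriv j φ p • (q.fst + r.fst : HeisL2 n) p
      = - ∫ p, φ p • (q.snd j + r.snd j : HeisL2 n) p
    rw [key _ hd hdc, key _ hφ.continuous hc, e1, e2]
    ring
  smul_mem' := by
    intro c q hq j φ hφ hc
    have key : ∀ (ψ : Heis n → ℝ) (a : HeisL2 n),
        ∫ p, ψ p • (c • a : HeisL2 n) p = c * ∫ p, ψ p • a p := by
      intro ψ a
      rw [← integral_const_mul]
      refine integral_congr_ae ?_
      filter_upwards [Lp.coeFn_smul c a] with p hp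
      rw [hp, Pi.smul_apply, smul_eq_mul, mul_smul_comm]
    have e1 := hq j φ hφ hc
    change ∫ p, horizontalDeriv j φ p • (c • q.fst : HeisL2 n) p
      = - ∫ p, φ p • (c • q.snd j : HeisL2 n) p
    rw [key, key, e1]
    ring

/-- The Sobolev space `H¹` of the sub-Laplacian, with its Hilbert norm. -/
abbrev HeisH1 (n : ℕ) : Type := sobolevGraph n

/-- The `L²` function underlying an element of `H¹`. -/
def HeisH1.toL2 {n : ℕ} (u : HeisH1 n) : HeisL2 n := u.1.fst

/-- The components of the weak horizontal gradient of an element of `H¹`. -/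
def HeisH1.grad {n : ℕ} (u : HeisH1 n) (j : Fin n ⊕ Fin n) : HeisL2 n := u.1.snd j

/-- The dual `H⁻¹` of `H¹`. -/
abbrev HeisHneg1 (n : ℕ) : Type := StrongDual ℂ (HeisH1 n)

/-- The bilinear pairing `∫ u v dx` (without conjugation). -/
def bilinPair {n : ℕ} (u v : HeisL2 n) : ℂ := ∫ p, u p * v p

/-- The potential `F(z) = g(|z|)`. -/
def potential (g : ℝ → ℝ) (z : ℂ) : ℝ := g ‖z‖

/-- The nonlinearity `f(z) = g'(|z|) z / |z|`, with `f(0) = 0`. -/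
def nonlinearity (g : ℝ → ℝ) (z : ℂ) : ℂ := ((deriv g ‖z‖ : ℝ) : ℂ) * z / ((‖z‖ : ℝ) : ℂ)

/-- The energy of the data `(u₀, u₁)`. -/
def initialEnergy {n : ℕ} (m : ℝ) (g : ℝ → ℝ) (u₀ : HeisH1 n) (u₁ : HeisL2 n) : ℝ :=
  1 / 2 * ‖u₁‖ ^ 2 + m / 2 * ‖u₀.toL2‖ ^ 2 + 1 / 2 * ∑ j, ‖u₀.grad j‖ ^ 2
    - ∫ p, potential g (u₀.toL2 p)

/-- The Nehari functional. -/
def nehari {n : ℕ} (m : ℝ) (g : ℝ → ℝ) (u : HeisH1 n) : ℝ :=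
  m * ‖u.toL2‖ ^ 2 + ∑ j, ‖u.grad j‖ ^ 2
    - (∫ p, nonlinearity g (u.toL2 p) * conj (u.toL2 p)).re

/-- `u` is a weak solution of `u_tt - 𝓛 u + b u_t + m u = f(u)`, `u(0) = u₀`, `u_t(0) = u₁`,
on the compact time interval `[0, S]`. The functions `ut`, `Ut` and `utt` are `u_t` as an element of
`C([0,S]; L²)`, `u_t` as an element of `L²(0,S; H¹)`, and `u_tt ∈ L²(0,S; H⁻¹)`. The function `K`
expresses that `f(u) ∈ L²(0,S; H⁻¹)`, acting through absolutely convergent integrals. -/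
def IsWeakSolutionOn {n : ℕ} (b m : ℝ) (g : ℝ → ℝ) (u₀ : HeisH1 n) (u₁ : HeisL2 n)
    (u : ℝ → HeisH1 n) (S : ℝ) : Prop :=
  ContinuousOn u (Icc 0 S) ∧ u 0 = u₀ ∧
  ∃ (ut : ℝ → HeisL2 n) (Ut : ℝ → HeisH1 n) (utt : ℝ → HeisHneg1 n) (K : ℝ → ℝ),
    -- `u ∈ C¹([0,S]; L²)` with derivative `ut`, and the initial velocity
    (∀ t ∈ Icc 0 S, HasDerivWithinAt (fun s => (u s).toL2) (ut t) (Icc 0 S) t) ∧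
    ContinuousOn ut (Icc 0 S) ∧ ut 0 = u₁ ∧
    -- `u_t ∈ L²(0,S; H¹)`
    MemLp Ut 2 (volume.restrict (Icc 0 S)) ∧
    (∀ᵐ t ∂(volume.restrict (Icc 0 S)), (Ut t).toL2 = ut t) ∧
    -- `u_tt ∈ L²(0,S; H⁻¹)` is the time derivative of `u_t`
    MemLp utt 2 (volume.restrict (Icc 0 S)) ∧
    (∀ v : HeisH1 n, ∀ t ∈ Icc 0 S,
      bilinPair (ut t) v.toL2 - bilinPair u₁ v.toL2 = ∫ s in (0 : ℝ)..t, utt s v) ∧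
    -- `f(u) ∈ L²(0,S; H⁻¹)`
    MemLp K 2 (volume.restrict (Icc 0 S)) ∧
    (∀ᵐ t ∂(volume.restrict (Icc 0 S)), ∀ v : HeisH1 n,
      Integrable (fun p => nonlinearity g ((u t).toL2 p) * v.toL2 p) ∧
      ∫ p, ‖nonlinearity g ((u t).toL2 p) * v.toL2 p‖ ≤ K t * ‖v‖) ∧
    -- the weak form of the equation
    (∀ᵐ t ∂(volume.restrict (Icc 0 S)), ∀ v : HeisH1 n,
      (utt t v).re + (∑ j, bilinPair ((u t).grad j) (v.grad j)).re
        + m * (bilinPair (u t).toL2 v.toL2).re + b * (bilinPair (ut t) v.toL2).re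
        = (∫ p, nonlinearity g ((u t).toL2 p) * v.toL2 p).re)

/-- `u` is a weak solution on `[0, T)`, where `0 < T ≤ ∞`; square integrability in time is local,
that is, on each `[0, S]` with `S < T`. Values of `u` outside `[0, T)` are irrelevant. -/
def IsWeakSolution {n : ℕ} (b m : ℝ) (g : ℝ → ℝ) (u₀ : HeisH1 n) (u₁ : HeisL2 n)
    (u : ℝ → HeisH1 n) (T : EReal) : Prop :=
  0 < T ∧ ∀ S : ℝ, 0 < S → (S : EReal) < T → IsWeakSolutionOn b m g u₀ u₁ u S

/-- `w` blows up at the finite time `T`: it is a weak solution on `[0, T)` with maximal existence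
time `T`, so that no weak solution on a longer interval continues it. -/
def BlowsUpAt {n : ℕ} (b m : ℝ) (g : ℝ → ℝ) (u₀ : HeisH1 n) (u₁ : HeisL2 n)
    (w : ℝ → HeisH1 n) (T : ℝ) : Prop :=
  IsWeakSolution b m g u₀ u₁ w T ∧
  ¬ ∃ (T' : EReal) (w' : ℝ → HeisH1 n), (T : EReal) < T' ∧
    IsWeakSolution b m g u₀ u₁ w' T' ∧ ∀ t : ℝ, 0 ≤ t → t < T → w' t = w t

end

/-! The proof is Levine's concavity method. Write M = ‖u‖², r = Re(u, u_t), v = ‖u_t‖². Testing the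
equation with the conjugate of u_t gives the energy identity E(t) + b∫₀ᵗ v = E(0). Testing with the
conjugate of u, using αF(z) ≤ Re f(z)z̄ and eliminating ∫F(u) through the energy identity, one gets
in integrated form (2r + bM)' ≥ (α+2)v + (α−2)mM − 2αE(0) + 2αb∫₀ᵗ v.

Put κ = m(α−2)/(μ+1). Since 2r ≤ M + v and b ≤ μ, the excess y = 2r + bM − 2αE(0)/κ satisfies y' ≥
κy. The hypothesis on Re(u₀,u₁) says y(0) ≥ bM(0), so y stays positive and grows at least linearly,
and the term with E(0) is absorbed whatever its sign. The condition I(u₀) < 0 enters only through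
M(0) > 0.

Now P(t) = M + b∫₀ᵗ M + b(T₀−t)M(0) has P' = 2(r + b∫₀ᵗ r), so P'² ≤ 4P(v + b∫₀ᵗ v) by
Cauchy–Schwarz, and PP'' ≥ (1+γ)P'² with 4(1+γ) = α+2−κ. Thus P^(−γ) is concave, which bounds the
lifespan by P/(γP') at any starting time with P' > 0 (`lifespan_sub_le`). Starting at 0 yields the
stated estimate. Starting late, when P' is large, excludes global solutions even if r(0) ≤ 0
(`not_global`). A maximal continuation, from Zorn's lemma, therefore ends at a finite time.

Two facts make this rigorous for weak solutions. The product rule `diagonal_sub_eq_integral`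
differentiates pairings when u_tt is only in H⁻¹, by Steklov averages and continuity of translations
in L². The chain rule `integral_potential_sub_eq_integral` differentiates ∫F(u) without any growth
condition on g, by approximating the positive and negative parts of g' from below by Lipschitz
functions. -/

open Filter Topology

/-! ### Continuity of translations in L² -/

section Translation

variable {E : Type*} [NormedAddCommGroup E]

/-- Translation in `L²(ℝ; E)`. -/
noncomputable def translateLp (τ : ℝ) (f : Lp E 2 (volume : Measure ℝ)) :
    Lp E 2 (volume : Measure ℝ) :=
  Lp.compMeasurePreserving (fun x => x + τ) (measurePreserving_add_right volume τ) f

theorem continuous_translateLp (f : Lp E 2 (volume : Measure ℝ)) :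
    Continuous fun τ : ℝ => translateLp τ f := by
  let g : C(ℝ, C(ℝ, ℝ)) :=
    (ContinuousMap.mk (fun a : ℝ × ℝ ↦ a.2 + a.1) (by fun_prop)).curry
  exact (continuous_const (y := f)).compMeasurePreservingLp g.continuous
    (fun τ => measurePreserving_add_right volume τ) (by norm_num)

theorem coeFn_translateLp (τ : ℝ) {W : ℝ → E} (hW : MemLp W 2 volume) :
    translateLp τ (hW.toLp W) =ᵐ[volume] fun x => W (x + τ) := by
  refine (Lp.coeFn_compMeasurePreserving _ _).trans ?_
  exact (measurePreserving_add_right volume τ).quasiMeasurePreserving.ae_eq_comp hW.coeFn_toLp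

end Translation

/-! ### Convergence of Steklov averages of pairings -/

section SteklovAverages

variable {E F : Type*} [NormedAddCommGroup E] [NormedSpace ℝ E]
  [NormedAddCommGroup F] [NormedSpace ℝ F]

/-- Translation is continuous in L² and the Hölder pairing L² × L² → L¹ is continuous, so the two
shifts may vary independently. -/
theorem tendsto_setIntegral_translate_pairing (L : E →L[ℝ] F →L[ℝ] ℝ) {W : ℝ → E} {B : ℝ → F}
    (hW : MemLp W 2 volume) (hB : MemLp B 2 volume) (s : Set ℝ) :
    Tendsto (fun p : ℝ × ℝ => ∫ x in s, L (W (x + p.1)) (B (x + p.2))) (𝓝 (0, 0))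
      (𝓝 (∫ x in s, L (W x) (B x))) := by
  have key : ∀ p : ℝ × ℝ, ∫ x in s, L (W (x + p.1)) (B (x + p.2)) =
      ∫ x in s, L.holderL volume 2 2 1 (translateLp p.1 (hW.toLp W))
        (translateLp p.2 (hB.toLp B)) x := by
    intro p
    refine integral_congr_ae (ae_restrict_of_ae ?_)
    filter_upwards [coeFn_translateLp p.1 hW, coeFn_translateLp p.2 hB,
      L.coeFn_holder (r := 1) (translateLp p.1 (hW.toLp W)) (translateLp p.2 (hB.toLp B))]
      with x h1 h2 h3
    rw [← h1, ← h2]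
    exact h3.symm
  have hc : Continuous fun p : ℝ × ℝ =>
      ∫ x in s, L.holderL volume 2 2 1 (translateLp p.1 (hW.toLp W))
        (translateLp p.2 (hB.toLp B)) x := by
    refine (continuous_setIntegral s).comp ?_
    exact ((L.holderL volume 2 2 1).continuous.comp
      ((continuous_translateLp _).comp continuous_fst)).clm_apply
      ((continuous_translateLp _).comp continuous_snd)
  have h := hc.tendsto (0, 0)
  rw [← key (0, 0)] at h
  simpa only [← key, add_zero] using h

/-- This justifies Fubini for Steklov averages: for each s the integral of ‖W(s+τ)‖² over τ is at
most the full ‖W‖² in L²(ℝ), so (s, τ) ↦ W(s+τ) is square integrable on the rectangle. -/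
theorem integrable_translate_pairing (L : E →L[ℝ] F →L[ℝ] ℝ) {W : ℝ → E} {B : ℝ → F}
    (hW : MemLp W 2 volume) (hB : MemLp B 2 volume) {T : ℝ} (h ρ : ℝ) :
    Integrable (fun p : ℝ × ℝ => L (W (p.1 + p.2)) (B (p.1 + ρ)))
      ((volume.restrict (Ioc 0 T)).prod (volume.restrict (Ioc 0 h))) := by
  have hsum : AEStronglyMeasurable (fun p : ℝ × ℝ => W (p.1 + p.2))
      ((volume : Measure ℝ).prod volume) :=
    hW.1.comp_quasiMeasurePreserving
      (MeasureTheory.quasiMeasurePreserving_add volume volume)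
  have hWm : AEStronglyMeasurable (fun p : ℝ × ℝ => W (p.1 + p.2))
      ((volume.restrict (Ioc 0 T)).prod (volume.restrict (Ioc 0 h))) := by
    rw [Measure.prod_restrict]
    exact hsum.restrict
  have hBτ : MemLp (fun x => B (x + ρ)) 2 volume :=
    hB.comp_measurePreserving (measurePreserving_add_right volume ρ)
  have hWL : MemLp (fun p : ℝ × ℝ => W (p.1 + p.2)) 2
      ((volume.restrict (Ioc 0 T)).prod (volume.restrict (Ioc 0 h))) := by
    have hWm2 : AEStronglyMeasurable (fun p : ℝ × ℝ => ‖W (p.1 + p.2)‖ ^ 2)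
      ((volume.restrict (Ioc 0 T)).prod (volume.restrict (Ioc 0 h))) := hWm.norm.pow 2
    rw [memLp_two_iff_integrable_sq_norm hWm, integrable_prod_iff hWm2]
    have hi : Integrable (fun x => ‖W x‖ ^ 2) := (memLp_two_iff_integrable_sq_norm hW.1).1 hW
    refine ⟨Eventually.of_forall fun x => ((hi.comp_add_left x).restrict), ?_⟩
    refine Integrable.mono' (integrable_const (∫ x, ‖W x‖ ^ 2))
      hWm2.norm.integral_prod_right' (Eventually.of_forall fun x => ?_)
    rw [Real.norm_of_nonneg (integral_nonneg fun _ => norm_nonneg _)]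
    simp only [Real.norm_of_nonneg (sq_nonneg _)]
    calc ∫ y in Ioc 0 h, ‖W (x + y)‖ ^ 2 ≤ ∫ y, ‖W (x + y)‖ ^ 2 :=
          setIntegral_le_integral (hi.comp_add_left x) (Eventually.of_forall fun _ => sq_nonneg _)
      _ = ∫ y, ‖W y‖ ^ 2 := integral_add_left_eq_self (fun y => ‖W y‖ ^ 2) x
  have hBL : MemLp (fun p : ℝ × ℝ => B (p.1 + ρ)) 2
      ((volume.restrict (Ioc 0 T)).prod (volume.restrict (Ioc 0 h))) :=
    (hBτ.restrict (Ioc 0 T)).comp_fst _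
  exact memLp_one_iff_integrable.1 (L.memLp_of_bilin 1 hWL hBL)

/-- After exchanging the integrals, the expression is the mean over 0 < τ ≤ h of a function of the
shifts (τ, σh) that is continuous at the origin. The values σ = 1 and σ = 0 serve the two halves of
the product rule. -/
theorem tendsto_steklov_pairing (L : E →L[ℝ] F →L[ℝ] ℝ) {W : ℝ → E} {B : ℝ → F}
    (hW : MemLp W 2 volume) (hB : MemLp B 2 volume) {T : ℝ} (hT : 0 ≤ T) (σ : ℝ) :
    Tendsto (fun h : ℝ => h⁻¹ * ∫ s in (0 : ℝ)..T, ∫ τ in (0 : ℝ)..h,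
        L (W (s + τ)) (B (s + σ * h))) (𝓝[>] 0)
      (𝓝 (∫ s in (0 : ℝ)..T, L (W s) (B s))) := by
  have hlim := tendsto_setIntegral_translate_pairing L hW hB (Ioc 0 T)
  set J : ℝ × ℝ → ℝ := fun p => ∫ x in Ioc 0 T, L (W (x + p.1)) (B (x + p.2)) with hJ
  rw [intervalIntegral.integral_of_le hT]
  set J0 := ∫ x in Ioc 0 T, L (W x) (B x) with hJ0
  rw [Metric.tendsto_nhds]
  intro ε hε
  obtain ⟨δ, hδ, hball⟩ := Metric.eventually_nhds_iff.1 (Metric.tendsto_nhds.1 hlim (ε / 2)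
    (half_pos hε))
  have hσ : 0 < δ / (|σ| + 1) := by positivity
  filter_upwards [Ioo_mem_nhdsGT (lt_min hδ hσ)] with h hh
  have h0 : 0 < h := hh.1
  have hhδ : h < δ := hh.2.trans_le (min_le_left _ _)
  have hhσ : |σ * h| < δ := by
    have := hh.2.trans_le (min_le_right _ _)
    rw [lt_div_iff₀ (by positivity)] at this
    rw [abs_mul, abs_of_pos h0]
    nlinarith [abs_nonneg σ]
  have hint := integrable_translate_pairing L hW hB (T := T) h (σ * h)
  have hswap : (∫ s in (0 : ℝ)..T, ∫ τ in (0 : ℝ)..h, L (W (s + τ)) (B (s + σ * h)))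
      = ∫ τ in Ioc 0 h, J (τ, σ * h) := by
    rw [intervalIntegral.integral_of_le hT]
    simp only [intervalIntegral.integral_of_le h0.le]
    exact integral_integral_swap hint
  have hJi : Integrable (fun τ => J (τ, σ * h)) (volume.restrict (Ioc 0 h)) :=
    hint.integral_prod_right
  have hdiff : (∫ τ in Ioc 0 h, J (τ, σ * h)) - h * J0
      = ∫ τ in Ioc 0 h, (J (τ, σ * h) - J0) := by
    rw [integral_sub hJi (integrable_const _)]
    simp [h0.le]
  have hbound : ‖∫ τ in Ioc 0 h, (J (τ, σ * h) - J0)‖ ≤ ε / 2 * h := by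
    have := norm_setIntegral_le_of_norm_le_const (μ := volume) (s := Ioc 0 h) (C := ε / 2)
      (f := fun τ => J (τ, σ * h) - J0) (by simp) (fun τ hτ => ?_)
    · simpa [h0.le] using this
    · have := hball (y := (τ, σ * h)) (by
        rw [Prod.dist_eq, max_lt_iff]
        simp only [Real.dist_eq, sub_zero]
        refine ⟨?_, hhσ⟩
        rw [abs_of_pos hτ.1]
        exact hτ.2.trans_lt hhδ)
      exact (Real.dist_eq _ _ ▸ this).le
  rw [hswap, Real.dist_eq]
  have : h⁻¹ * (∫ τ in Ioc 0 h, J (τ, σ * h)) - J0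
      = h⁻¹ * ((∫ τ in Ioc 0 h, J (τ, σ * h)) - h * J0) := by
    field_simp
  rw [this, hdiff, abs_mul, abs_of_pos (inv_pos.2 h0)]
  calc h⁻¹ * |∫ τ in Ioc 0 h, (J (τ, σ * h) - J0)| ≤ h⁻¹ * (ε / 2 * h) := by
        gcongr
        exact hbound
    _ = ε / 2 := by field_simp
    _ < ε := half_lt_self hε

theorem intervalIntegrable_steklov_pairing (L : E →L[ℝ] F →L[ℝ] ℝ) {W : ℝ → E} {B : ℝ → F}
    (hW : MemLp W 2 volume) (hB : MemLp B 2 volume) {T h : ℝ} (hT : 0 ≤ T) (hh : 0 ≤ h) (ρ : ℝ) :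
    IntervalIntegrable (fun s => ∫ τ in (0 : ℝ)..h, L (W (s + τ)) (B (s + ρ))) volume 0 T := by
  rw [intervalIntegrable_iff_integrableOn_Ioc_of_le hT]
  simp only [intervalIntegral.integral_of_le hh]
  exact (integrable_translate_pairing L hW hB (T := T) h ρ).integral_prod_left

theorem intervalIntegrable_pairing (L : E →L[ℝ] F →L[ℝ] ℝ) {W : ℝ → E} {B : ℝ → F} {S T : ℝ}
    (hW : MemLp W 2 (volume.restrict (Icc 0 S))) (hB : MemLp B 2 (volume.restrict (Icc 0 S)))
    (hT : 0 ≤ T) (hTS : T ≤ S) : IntervalIntegrable (fun s => L (W s) (B s)) volume 0 T := by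
  rw [intervalIntegrable_iff_integrableOn_Icc_of_le hT]
  exact IntegrableOn.mono_set (memLp_one_iff_integrable.1 (L.memLp_of_bilin 1 hW hB))
    (Icc_subset_Icc_right hTS)

theorem integral_indicator_pairing (L : E →L[ℝ] F →L[ℝ] ℝ) (W : ℝ → E) (B : ℝ → F) {S T : ℝ}
    (hT : 0 ≤ T) (hTS : T ≤ S) :
    (∫ s in (0 : ℝ)..T, L ((Icc 0 S).indicator W s) ((Icc 0 S).indicator B s))
      = ∫ s in (0 : ℝ)..T, L (W s) (B s) := by
  refine intervalIntegral.integral_congr fun s hs => ?_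
  rw [uIcc_of_le hT] at hs
  have hs' : s ∈ Icc 0 S := ⟨hs.1, hs.2.trans hTS⟩
  simp only [indicator_of_mem hs']

theorem integral_indicator_shift_pairing (L : E →L[ℝ] F →L[ℝ] ℝ) (W : ℝ → E) (B : ℝ → F)
    {S h s x : ℝ} (hh : 0 ≤ h) (hs0 : s ∈ Icc 0 S) (hs1 : s + h ∈ Icc 0 S) (hx : x ∈ Icc 0 S) :
    (∫ τ in (0 : ℝ)..h, L ((Icc 0 S).indicator W (s + τ)) ((Icc 0 S).indicator B x))
      = ∫ q in s..(s + h), L (W q) (B x) := by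
  rw [intervalIntegral.integral_comp_add_left
    (fun q => L ((Icc 0 S).indicator W q) ((Icc 0 S).indicator B x)), add_zero]
  refine intervalIntegral.integral_congr fun q hq => ?_
  rw [uIcc_of_le (by linarith)] at hq
  have hq' : q ∈ Icc 0 S := ⟨hs0.1.trans hq.1, hq.2.trans hs1.2⟩
  simp only [indicator_of_mem hq', indicator_of_mem hx]

end SteklovAverages

/-! ### The product rule for weakly differentiable curves -/

section ProductRule

variable {E₁ F₁ E₂ F₂ : Type*} [NormedAddCommGroup E₁] [NormedSpace ℝ E₁]
  [NormedAddCommGroup F₁] [NormedSpace ℝ F₁] [NormedAddCommGroup E₂] [NormedSpace ℝ E₂]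
  [NormedAddCommGroup F₂] [NormedSpace ℝ F₂]

/-- With G a primitive of d, the average equals (G(T+h) − G(T))/h − G(h)/h, a difference of two
difference quotients. -/
theorem tendsto_steklov_increment {d : ℝ → ℝ} {S T : ℝ} (hT : 0 ≤ T) (hTS : T < S)
    (hd : ContinuousOn d (Icc 0 S)) :
    Tendsto (fun h : ℝ => h⁻¹ * ∫ s in (0 : ℝ)..T, (d (s + h) - d s)) (𝓝[>] 0)
      (𝓝 (d T - d 0)) := by
  have hS : 0 ≤ S := hT.trans hTS.le
  set D : ℝ → ℝ := IccExtend hS ((Icc 0 S).domRestrict d) with hD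
  have hDc : Continuous D := (continuousOn_iff_continuous_domRestrict.1 hd).Icc_extend'
  have hDd : ∀ x ∈ Icc 0 S, D x = d x := fun x hx => by rw [hD, IccExtend_of_mem _ _ hx]; rfl
  set G : ℝ → ℝ := fun x => ∫ s in (0 : ℝ)..x, D s with hG
  have hGd : ∀ x, HasDerivAt G (D x) x := fun x =>
    intervalIntegral.integral_hasDerivAt_right (hDc.intervalIntegrable _ _)
      (hDc.stronglyMeasurableAtFilter _ _) hDc.continuousAt
  have h1 := (hGd T).tendsto_slope_zero_right
  have h0 := (hGd 0).tendsto_slope_zero_right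
  rw [hDd T ⟨hT, hTS.le⟩] at h1
  rw [hDd 0 ⟨le_rfl, hS⟩] at h0
  refine (h1.sub h0).congr' ?_
  filter_upwards [Ioo_mem_nhdsGT (sub_pos.2 hTS)] with h hh
  have e : (∫ s in (0 : ℝ)..T, (d (s + h) - d s)) = ∫ s in (0 : ℝ)..T, (D (s + h) - D s) := by
    refine intervalIntegral.integral_congr fun s hs => ?_
    rw [uIcc_of_le hT] at hs
    have := hh.1
    have := hh.2
    rw [hDd (s + h) ⟨by linarith [hs.1], by linarith [hs.2]⟩, hDd s ⟨hs.1, by linarith [hs.2]⟩]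
  have ii : ∀ a b, IntervalIntegrable D volume a b := fun a b => hDc.intervalIntegrable a b
  have ih : IntervalIntegrable (fun s => D (s + h)) volume 0 T :=
    (hDc.comp (continuous_id.add continuous_const)).intervalIntegrable _ _
  rw [e, intervalIntegral.integral_sub ih (ii _ _),
    intervalIntegral.integral_comp_add_right]
  have e1 : (∫ s in (0 + h)..(T + h), D s) = G (T + h) - G h := by
    rw [zero_add, hG]
    exact (intervalIntegral.integral_interval_sub_left (ii _ _) (ii _ _)).symm
  rw [e1]
  have e0 : G 0 = 0 := by simp [hG]
  simp only [zero_add, e0, smul_eq_mul, sub_zero]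
  change h⁻¹ * (G (T + h) - G T) - h⁻¹ * G h = h⁻¹ * (G (T + h) - G h - G T)
  ring

/-- The product rule for `t ↦ c t t`, where `c s t = ⟨a s, b t⟩` and the two functions `a`, `b` have
square integrable weak derivatives `W` and `Z` that pair with the square integrable representatives
`B` of `b` and `A` of `a`. -/
theorem diagonal_sub_eq_integral {c : ℝ → ℝ → ℝ} {S T : ℝ} (hT : 0 ≤ T) (hTS : T < S)
    (L₁ : E₁ →L[ℝ] F₁ →L[ℝ] ℝ) (L₂ : E₂ →L[ℝ] F₂ →L[ℝ] ℝ)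
    {W : ℝ → E₁} {B : ℝ → F₁} {Z : ℝ → E₂} {A : ℝ → F₂}
    (hW : MemLp W 2 (volume.restrict (Icc 0 S))) (hB : MemLp B 2 (volume.restrict (Icc 0 S)))
    (hZ : MemLp Z 2 (volume.restrict (Icc 0 S))) (hA : MemLp A 2 (volume.restrict (Icc 0 S)))
    (hc : ContinuousOn (fun t => c t t) (Icc 0 S))
    (h₁ : ∀ᵐ t ∂(volume.restrict (Icc 0 S)), ∀ s ∈ Icc 0 S, ∀ s' ∈ Icc 0 S,
      c s t - c s' t = ∫ r in s'..s, L₁ (W r) (B t))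
    (h₂ : ∀ᵐ s ∂(volume.restrict (Icc 0 S)), ∀ t ∈ Icc 0 S, ∀ t' ∈ Icc 0 S,
      c s t - c s t' = ∫ r in t'..t, L₂ (Z r) (A s)) :
    c T T - c 0 0 = ∫ s in (0 : ℝ)..T, (L₁ (W s) (B s) + L₂ (Z s) (A s)) := by
  have hm : MeasurableSet (Icc (0 : ℝ) S) := measurableSet_Icc
  rw [ae_restrict_iff' hm] at h₁ h₂
  -- Extension by zero puts the functions in L²(ℝ), where translations act.
  have hW' := (memLp_indicator_iff_restrict hm).2 hW
  have hB' := (memLp_indicator_iff_restrict hm).2 hB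
  have hZ' := (memLp_indicator_iff_restrict hm).2 hZ
  have hA' := (memLp_indicator_iff_restrict hm).2 hA
  -- The increment c(s+h, s+h) − c(s, s) is split at c(s, s+h): the first part pairs with B(s+h),
  -- hence σ = 1, and the second with A(s), hence σ = 0.
  have lim₁ := tendsto_steklov_pairing L₁ hW' hB' hT 1
  have lim₂ := tendsto_steklov_pairing L₂ hZ' hA' hT 0
  rw [intervalIntegral.integral_add (intervalIntegrable_pairing L₁ hW hB hT hTS.le)
    (intervalIntegrable_pairing L₂ hZ hA hT hTS.le),
    ← integral_indicator_pairing L₁ W B hT hTS.le, ← integral_indicator_pairing L₂ Z A hT hTS.le]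
  refine tendsto_nhds_unique (tendsto_steklov_increment hT hTS hc) ((lim₁.add lim₂).congr' ?_)
  filter_upwards [Ioo_mem_nhdsGT (sub_pos.2 hTS)] with h hh
  have hh0 := hh.1
  have hh1 := hh.2
  rw [← mul_add, one_mul, zero_mul, ← intervalIntegral.integral_add
    (intervalIntegrable_steklov_pairing L₁ hW' hB' hT hh0.le h)
    (intervalIntegrable_steklov_pairing L₂ hZ' hA' hT hh0.le 0)]
  congr 1
  refine intervalIntegral.integral_congr_ae ?_
  -- The increment formula in the first variable holds for almost every value of the second, and is
  -- needed at s + h; translation preserves null sets.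
  have h₁' : ∀ᵐ s : ℝ, s + h ∈ Icc 0 S → ∀ r ∈ Icc 0 S, ∀ r' ∈ Icc 0 S,
      c r (s + h) - c r' (s + h) = ∫ q in r'..r, L₁ (W q) (B (s + h)) :=
    (measurePreserving_add_right volume h).quasiMeasurePreserving.ae h₁
  filter_upwards [h₁', h₂] with s g₁ g₂ hs
  rw [uIoc_of_le hT] at hs
  have hs0 : s ∈ Icc 0 S := ⟨hs.1.le, by linarith [hs.2]⟩
  have hs1 : s + h ∈ Icc 0 S := ⟨by linarith [hs.1], by linarith [hs.2]⟩
  rw [integral_indicator_shift_pairing L₁ W B hh0.le hs0 hs1 hs1, add_zero,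
    integral_indicator_shift_pairing L₂ Z A hh0.le hs0 hs1 hs0, ← g₁ hs1 _ hs1 _ hs0,
    ← g₂ hs0 _ hs1 _ hs0]
  ring

end ProductRule

/-! ### Lipschitz approximation from below -/

section LipschitzRegularization

/-- The largest `k`-Lipschitz minorant of `ψ`. -/
noncomputable def lipschitzMinorant (ψ : ℝ → ℝ) (k : ℕ) (r : ℝ) : ℝ := ⨅ s, (ψ s + k * |r - s|)

variable {ψ : ℝ → ℝ} (hψ : ∀ r, 0 ≤ ψ r)
include hψ

theorem lipschitzMinorant_bddBelow (k : ℕ) (r : ℝ) :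
    BddBelow (range fun s => ψ s + k * |r - s|) :=
  ⟨0, by rintro _ ⟨s, rfl⟩; exact add_nonneg (hψ s) (by positivity)⟩

theorem lipschitzMinorant_nonneg (k : ℕ) (r : ℝ) : 0 ≤ lipschitzMinorant ψ k r :=
  le_ciInf fun s => add_nonneg (hψ s) (by positivity)

theorem lipschitzMinorant_le (k : ℕ) (r : ℝ) : lipschitzMinorant ψ k r ≤ ψ r :=
  (ciInf_le (lipschitzMinorant_bddBelow hψ k r) r).trans (by simp)

theorem lipschitzMinorant_sub_le (k : ℕ) (r r' : ℝ) :
    |lipschitzMinorant ψ k r - lipschitzMinorant ψ k r'| ≤ k * |r - r'| := by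
  have key : ∀ x y : ℝ, lipschitzMinorant ψ k x ≤ lipschitzMinorant ψ k y + k * |x - y| := by
    intro x y
    rw [← sub_le_iff_le_add]
    refine le_ciInf fun s => ?_
    rw [sub_le_iff_le_add]
    refine (ciInf_le (lipschitzMinorant_bddBelow hψ k x) s).trans ?_
    have := abs_sub_le x y s
    have hk : (0 : ℝ) ≤ k := k.cast_nonneg
    nlinarith [mul_le_mul_of_nonneg_left this hk]
  have h1 := key r r'
  have h2 := key r' r
  rw [abs_sub_comm r' r] at h2
  exact abs_le.2 ⟨by linarith, by linarith⟩

/-- Near r, lower semicontinuity keeps ψ(s) above c'. At distance at least δ the penalty k|r − s|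
exceeds c' as soon as k ≥ c'/δ, since ψ ≥ 0. -/
theorem tendsto_lipschitzMinorant {r : ℝ} (hr : LowerSemicontinuousAt ψ r) :
    Tendsto (fun k => lipschitzMinorant ψ k r) atTop (𝓝 (ψ r)) := by
  rw [tendsto_order]
  refine ⟨fun c hc => ?_, fun c hc =>
    Eventually.of_forall fun k => (lipschitzMinorant_le hψ k r).trans_lt hc⟩
  obtain ⟨c', hcc', hc'⟩ := exists_between hc
  obtain ⟨δ, hδ, hball⟩ := Metric.eventually_nhds_iff.1 (hr c' hc')
  obtain ⟨K, hK⟩ := exists_nat_ge (c' / δ)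
  filter_upwards [eventually_ge_atTop K] with k hk
  refine hcc'.trans_le (le_ciInf fun s => ?_)
  by_cases hs : dist s r < δ
  · have := hball hs
    have h2 : (0 : ℝ) ≤ k * |r - s| := by positivity
    linarith
  · rw [Real.dist_eq, abs_sub_comm, not_lt] at hs
    have h1 : c' ≤ k * δ := by
      rw [div_le_iff₀ hδ] at hK
      refine hK.trans ?_
      gcongr
    have h2 : (k : ℝ) * δ ≤ k * |r - s| := by gcongr
    linarith [hψ s]

end LipschitzRegularization

/-! ### Second-order expansion of radial primitives -/

section RadialPrimitive

/-- The directional derivative of `z ↦ ∫₀^|z| ψ` at `z` in the direction `w`. -/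
noncomputable def radialDeriv (ψ : ℝ → ℝ) (z w : ℂ) : ℝ := ψ ‖z‖ * ((z * conj w).re / ‖z‖)

theorem abs_re_mul_conj_div_norm_le (z w : ℂ) : |(z * conj w).re / ‖z‖| ≤ ‖w‖ := by
  rw [abs_div, abs_norm]
  refine div_le_of_le_mul₀ (norm_nonneg _) (norm_nonneg _) ?_
  refine (Complex.abs_re_le_norm _).trans ?_
  rw [norm_mul, RCLike.norm_conj, mul_comm]

theorem abs_radialDeriv_le {ψ : ℝ → ℝ} (hψ : ∀ r, 0 ≤ ψ r) (z w : ℂ) :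
    |radialDeriv ψ z w| ≤ ψ ‖z‖ * ‖w‖ := by
  rw [radialDeriv, abs_mul, abs_of_nonneg (hψ _)]
  exact mul_le_mul_of_nonneg_left (abs_re_mul_conj_div_norm_le z w) (hψ _)

/-- The Taylor remainder of the norm is of order |w|²/|z|, and the factor |z| removes the
singularity at 0. Multiplied out, the remainder is |z||z+w| − |z|² − Re(z w̄): nonnegative by
Cauchy–Schwarz, and bounded above by |z||z+w| ≤ (|z|² + |z+w|²)/2. -/
theorem abs_norm_add_sub_norm_sub_le (z w : ℂ) :
    ‖z‖ * |‖z + w‖ - ‖z‖ - (z * conj w).re / ‖z‖| ≤ ‖w‖ ^ 2 := by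
  rcases eq_or_ne z 0 with rfl | hz
  · simp only [norm_zero, zero_mul]
    positivity
  have ha : 0 < ‖z‖ := norm_pos_iff.2 hz
  have hb : 0 ≤ ‖z + w‖ := norm_nonneg _
  have hsq : ‖z + w‖ ^ 2 = ‖z‖ ^ 2 + 2 * (z * conj w).re + ‖w‖ ^ 2 := by
    rw [← Complex.normSq_eq_norm_sq, ← Complex.normSq_eq_norm_sq, ← Complex.normSq_eq_norm_sq,
      Complex.normSq_add]
    ring
  have hre : ‖z‖ ^ 2 + (z * conj w).re ≤ ‖z‖ * ‖z + w‖ := by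
    have h1 : (z * conj (z + w)).re = ‖z‖ ^ 2 + (z * conj w).re := by
      rw [map_add, mul_add, Complex.add_re, Complex.mul_conj, Complex.ofReal_re,
        Complex.normSq_eq_norm_sq]
    rw [← h1]
    refine (Complex.re_le_norm _).trans ?_
    rw [norm_mul, RCLike.norm_conj]
  have e : ‖z‖ * |‖z + w‖ - ‖z‖ - (z * conj w).re / ‖z‖|
      = |‖z‖ * ‖z + w‖ - ‖z‖ ^ 2 - (z * conj w).re| := by
    nth_rw 1 [← abs_of_pos ha]
    rw [← abs_mul]
    congr 1
    field_simp
  rw [e, abs_of_nonneg (by linarith)]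
  nlinarith [sq_nonneg (‖z + w‖ - ‖z‖), sq_nonneg ‖w‖]

theorem continuous_of_abs_sub_le {ψ : ℝ → ℝ} {k : ℝ} (hk : 0 ≤ k)
    (hψ : ∀ r r', |ψ r - ψ r'| ≤ k * |r - r'|) : Continuous ψ := by
  refine (LipschitzWith.of_dist_le_mul (K := k.toNNReal) fun r r' => ?_).continuous
  rw [Real.dist_eq, Real.dist_eq, Real.coe_toNNReal _ hk]
  exact hψ r r'

/-- One k comes from freezing ψ at |z| along the interval of integration, the other from expanding
the norm. In the latter, ψ(0) = 0 gives |ψ(|z|)| ≤ k|z|, exactly the factor that tames the expansion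
near z = 0. -/
theorem abs_integral_norm_sub_radialDeriv_le {ψ : ℝ → ℝ} {k : ℝ} (hk : 0 ≤ k)
    (hψ : ∀ r r', |ψ r - ψ r'| ≤ k * |r - r'|) (h0 : ψ 0 = 0) (z w : ℂ) :
    |(∫ r in (0 : ℝ)..‖z + w‖, ψ r) - (∫ r in (0 : ℝ)..‖z‖, ψ r) - radialDeriv ψ z w|
      ≤ 2 * k * ‖w‖ ^ 2 := by
  have hc : Continuous ψ := continuous_of_abs_sub_le hk hψ
  have hi : ∀ a b, IntervalIntegrable ψ volume a b := fun a b => hc.intervalIntegrable a b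
  rw [intervalIntegral.integral_interval_sub_left (hi _ _) (hi _ _)]
  set a := ‖z‖
  set b := ‖z + w‖
  have hab : |b - a| ≤ ‖w‖ := by simpa using abs_norm_sub_norm_le (z + w) z
  have h1 : |(∫ r in a..b, ψ r) - ψ a * (b - a)| ≤ k * ‖w‖ ^ 2 := by
    have e : (∫ r in a..b, ψ r) - ψ a * (b - a) = ∫ r in a..b, (ψ r - ψ a) := by
      rw [intervalIntegral.integral_sub (hi _ _) (by simp)]
      simp [mul_comm]
    rw [e]
    have := intervalIntegral.norm_integral_le_of_norm_le_const (a := a) (b := b)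
      (f := fun r => ψ r - ψ a) (C := k * |b - a|) (fun r hr => ?_)
    · rw [Real.norm_eq_abs] at this
      refine this.trans ?_
      rw [mul_assoc, ← sq]
      gcongr
    · refine (hψ r a).trans ?_
      refine mul_le_mul_of_nonneg_left ?_ hk
      rcases le_total a b with h | h
      · rw [uIoc_of_le h] at hr
        rw [abs_of_pos (by linarith [hr.1]), abs_of_nonneg (by linarith)]
        linarith [hr.2]
      · rw [uIoc_of_ge h] at hr
        rw [abs_of_nonpos (by linarith [hr.2]), abs_of_nonpos (by linarith)]
        linarith [hr.1]
  have h2 : |ψ a * (b - a) - radialDeriv ψ z w| ≤ k * ‖w‖ ^ 2 := by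
    rw [radialDeriv, ← mul_sub, abs_mul]
    have hψa : |ψ a| ≤ k * a := by
      have := hψ a 0
      rwa [h0, sub_zero, sub_zero, abs_of_nonneg (norm_nonneg z)] at this
    calc |ψ a| * |b - a - (z * conj w).re / a| ≤ k * a * |b - a - (z * conj w).re / a| := by gcongr
      _ = k * (a * |b - a - (z * conj w).re / a|) := by ring
      _ ≤ k * ‖w‖ ^ 2 := by
        gcongr
        exact abs_norm_add_sub_norm_sub_le z w
  calc _ = |((∫ r in a..b, ψ r) - ψ a * (b - a)) + (ψ a * (b - a) - radialDeriv ψ z w)| := by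
        congr 1; ring
    _ ≤ _ := abs_add_le _ _
    _ ≤ 2 * k * ‖w‖ ^ 2 := by linarith

end RadialPrimitive

/-! ### Differentiability of radial functionals on L² -/

section Functional

variable {Ω : Type*} [MeasurableSpace Ω] {ν : Measure Ω}

/-- The weighted integral of `∫₀^|v| ψ`. -/
noncomputable def radialFunctional (η : Ω → ℝ) (ψ : ℝ → ℝ) (v : Lp ℂ 2 ν) : ℝ :=
  ∫ p, η p * (∫ r in (0 : ℝ)..‖v p‖, ψ r) ∂ν

theorem integrable_norm_sq (v : Lp ℂ 2 ν) : Integrable (fun p => ‖v p‖ ^ 2) ν :=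
  (memLp_two_iff_integrable_sq_norm (Lp.memLp v).1).1 (Lp.memLp v)

theorem integral_norm_sq (v : Lp ℂ 2 ν) : ∫ p, ‖v p‖ ^ 2 ∂ν = ‖v‖ ^ 2 := by
  have h := congrArg Complex.re (L2.inner_def (𝕜 := ℂ) v v)
  rw [inner_self_eq_norm_sq_to_K] at h
  have e : ∀ p, inner ℂ (v p) (v p) = ((‖v p‖ ^ 2 : ℝ) : ℂ) := fun p => by
    rw [inner_self_eq_norm_sq_to_K]; norm_cast
  simp only [e, integral_complex_ofReal] at h
  rw [Complex.ofReal_re] at h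
  rw [← h]
  norm_cast

variable {η : Ω → ℝ} (hη : Measurable η) (hη1 : ∀ p, |η p| ≤ 1) {ψ : ℝ → ℝ} {k : ℝ} (hk : 0 ≤ k)
  (hψ : ∀ r r', |ψ r - ψ r'| ≤ k * |r - r'|) (h0 : ψ 0 = 0)

include hη hη1 hk hψ h0

theorem integrable_radialFunctional (v : Lp ℂ 2 ν) :
    Integrable (fun p => η p * ∫ r in (0 : ℝ)..‖v p‖, ψ r) ν := by
  have hc := continuous_of_abs_sub_le hk hψ
  have hΨ : Continuous fun x : ℝ => ∫ r in (0 : ℝ)..x, ψ r :=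
    intervalIntegral.continuous_primitive (fun a b => hc.intervalIntegrable a b) 0
  refine Integrable.mono' ((integrable_norm_sq v).const_mul (2 * k))
    (hη.aestronglyMeasurable.mul (hΨ.comp_aestronglyMeasurable (Lp.memLp v).1.norm))
    (Eventually.of_forall fun p => ?_)
  have := abs_integral_norm_sub_radialDeriv_le hk hψ h0 0 (v p)
  simp only [zero_add, norm_zero, intervalIntegral.integral_same, sub_zero, radialDeriv, zero_mul,
    Complex.zero_re, zero_div, mul_zero] at this
  rw [norm_mul, Real.norm_eq_abs, Real.norm_eq_abs]
  exact (mul_le_of_le_one_left (abs_nonneg _) (hη1 p)).trans this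

theorem memLp_radialField (v : Lp ℂ 2 ν) :
    MemLp (fun p => ((η p * ψ ‖v p‖ / ‖v p‖ : ℝ) : ℂ) * v p) 2 ν := by
  have hc := continuous_of_abs_sub_le hk hψ
  have hm : AEStronglyMeasurable (fun p => ((η p * ψ ‖v p‖ / ‖v p‖ : ℝ) : ℂ) * v p) ν := by
    refine AEStronglyMeasurable.mul ?_ (Lp.memLp v).1
    refine Complex.continuous_ofReal.comp_aestronglyMeasurable ?_
    have hv := (Lp.memLp v).1.norm
    exact ((hη.aemeasurable.mul (hc.comp_aestronglyMeasurable hv).aemeasurable).div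
      hv.aemeasurable).aestronglyMeasurable
  refine MemLp.of_le_mul (Lp.memLp v) hm (c := k) (Eventually.of_forall fun p => ?_)
  have hψa : |ψ ‖v p‖| ≤ k * ‖v p‖ := by
    have := hψ ‖v p‖ 0
    rwa [h0, sub_zero, sub_zero, abs_of_nonneg (norm_nonneg (v p))] at this
  rw [norm_mul, Complex.norm_real, Real.norm_eq_abs, abs_div, abs_mul, abs_norm]
  rcases eq_or_ne (v p) 0 with h | h
  · simp [h]
  · rw [div_mul_cancel₀ _ (norm_ne_zero_iff.2 h)]
    exact (mul_le_of_le_one_left (abs_nonneg _) (hη1 p)).trans hψa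

theorem inner_radialField_ae (v w : Lp ℂ 2 ν) :
    (fun p => RCLike.re (inner ℂ ((memLp_radialField hη hη1 hk hψ h0 v).toLp _ p) (w p)))
      =ᵐ[ν] fun p => η p * radialDeriv ψ (v p) (w p) := by
  filter_upwards [(memLp_radialField hη hη1 hk hψ h0 v).coeFn_toLp] with p hp
  rw [hp, RCLike.inner_apply, radialDeriv, RCLike.re_to_complex]
  have e : (w p * conj (((η p * ψ ‖v p‖ / ‖v p‖ : ℝ) : ℂ) * v p)).re
      = (η p * ψ ‖v p‖ / ‖v p‖) * (v p * conj (w p)).re := by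
    rw [map_mul, Complex.conj_ofReal, mul_left_comm, Complex.re_ofReal_mul]
    congr 1
    simp only [Complex.mul_re, Complex.conj_re, Complex.conj_im]
    ring
  rw [e]
  ring

theorem inner_radialField_re (v w : Lp ℂ 2 ν) :
    (inner ℂ ((memLp_radialField hη hη1 hk hψ h0 v).toLp _) w).re
      = ∫ p, η p * radialDeriv ψ (v p) (w p) ∂ν := by
  rw [L2.inner_def, ← RCLike.re_to_complex, ← integral_re (L2.integrable_inner _ _)]
  exact integral_congr_ae (inner_radialField_ae hη hη1 hk hψ h0 v w)

theorem integrable_mul_radialDeriv (v w : Lp ℂ 2 ν) :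
    Integrable (fun p => η p * radialDeriv ψ (v p) (w p)) ν :=
  (L2.integrable_inner (𝕜 := ℂ) ((memLp_radialField hη hη1 hk hψ h0 v).toLp _) w).re.congr
    (inner_radialField_ae hη hη1 hk hψ h0 v w)

/-- The pointwise remainder is at most 2k|w|², uniformly in the point, so it integrates to O(‖w‖²)
in L². Neither finite measure nor growth control beyond the Lipschitz bound is needed. -/
theorem hasFDerivAt_radialFunctional (v : Lp ℂ 2 ν) :
    HasFDerivAt (radialFunctional η ψ) (Complex.reCLM.comp ((innerSL ℂ
      ((memLp_radialField hη hη1 hk hψ h0 v).toLp _)).restrictScalars ℝ)) v := by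
  rw [hasFDerivAt_iff_isLittleO_nhds_zero]
  refine Asymptotics.IsBigO.trans_isLittleO (g := fun w : Lp ℂ 2 ν => ‖w‖ ^ 2)
    (Asymptotics.IsBigO.of_bound (2 * k) (Eventually.of_forall fun w => ?_))
    (Asymptotics.isLittleO_norm_pow_id one_lt_two)
  have e : (Complex.reCLM.comp ((innerSL ℂ
      ((memLp_radialField hη hη1 hk hψ h0 v).toLp _)).restrictScalars ℝ)) w
      = ∫ p, η p * radialDeriv ψ (v p) (w p) ∂ν := inner_radialField_re hη hη1 hk hψ h0 v w
  have i1 := integrable_radialFunctional hη hη1 hk hψ h0 (v + w)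
  have i2 := integrable_radialFunctional hη hη1 hk hψ h0 v
  have i3 := integrable_mul_radialDeriv hη hη1 hk hψ h0 v w
  rw [e, radialFunctional, radialFunctional, ← integral_sub i1 i2,
    ← integral_sub (by exact i1.sub i2) i3]
  refine (norm_integral_le_of_norm_le ((integrable_norm_sq w).const_mul (2 * k)) ?_).trans_eq ?_
  · filter_upwards [Lp.coeFn_add v w] with p hp
    rw [hp, Pi.add_apply, ← mul_sub, ← mul_sub, norm_mul, Real.norm_eq_abs, Real.norm_eq_abs]
    exact (mul_le_of_le_one_left (abs_nonneg _) (hη1 p)).trans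
      (abs_integral_norm_sub_radialDeriv_le hk hψ h0 (v p) (w p))
  · rw [integral_const_mul, integral_norm_sq, norm_pow, norm_norm]

/-- The fundamental theorem of calculus for a radial functional along a `C¹` curve in `L²`. -/
theorem radialFunctional_sub_eq_integral {u ut : ℝ → Lp ℂ 2 ν} {t : ℝ} (ht : 0 ≤ t)
    (hu : ContinuousOn u (Icc 0 t)) (hut : ContinuousOn ut (Icc 0 t))
    (hd : ∀ s ∈ Ioo 0 t, HasDerivAt u (ut s) s) :
    IntervalIntegrable (fun s => ∫ p, η p * radialDeriv ψ (u s p) (ut s p) ∂ν) volume 0 t ∧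
    radialFunctional η ψ (u t) - radialFunctional η ψ (u 0)
      = ∫ s in (0 : ℝ)..t, ∫ p, η p * radialDeriv ψ (u s p) (ut s p) ∂ν := by
  have hder : ∀ s ∈ Ioo 0 t, HasDerivAt (fun s => radialFunctional η ψ (u s))
      (∫ p, η p * radialDeriv ψ (u s p) (ut s p) ∂ν) s := by
    intro s hs
    have := (hasFDerivAt_radialFunctional hη hη1 hk hψ h0 (u s)).comp_hasDerivAt s (hd s hs)
    rw [← inner_radialField_re hη hη1 hk hψ h0]
    exact this
  have hcont : ContinuousOn (fun s => radialFunctional η ψ (u s)) (Icc 0 t) :=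
    (continuous_iff_continuousAt.2 fun v =>
      (hasFDerivAt_radialFunctional hη hη1 hk hψ h0 v).continuousAt).comp_continuousOn hu
  have hint : IntervalIntegrable (fun s => ∫ p, η p * radialDeriv ψ (u s p) (ut s p) ∂ν)
      volume 0 t := by
    rw [intervalIntegrable_iff_integrableOn_Ioo_of_le ht]
    have hb : IntegrableOn (fun s => k * (‖u s‖ ^ 2 + ‖ut s‖ ^ 2)) (Ioo 0 t) := by
      refine IntegrableOn.mono_set (t := Icc 0 t) ?_ Ioo_subset_Icc_self
      exact (ContinuousOn.mul continuousOn_const ((hu.norm.pow 2).add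
        (hut.norm.pow 2))).integrableOn_Icc
    refine Integrable.mono' hb ?_ ?_
    -- Measurability in time comes for free: the integrand is the derivative of a function of s.
    · refine (aestronglyMeasurable_deriv (fun s => radialFunctional η ψ (u s)) _).congr ?_
      filter_upwards [ae_restrict_mem measurableSet_Ioo] with s hs
      exact (hder s hs).deriv
    · refine Eventually.of_forall fun s => ?_
      rw [← integral_norm_sq, ← integral_norm_sq,
        ← integral_add (integrable_norm_sq _) (integrable_norm_sq _), ← integral_const_mul]
      refine norm_integral_le_of_norm_le (((integrable_norm_sq _).add
        (integrable_norm_sq _)).const_mul k) (Eventually.of_forall fun p => ?_)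
      have h1 : |ψ ‖u s p‖| ≤ k * ‖u s p‖ := by
        have := hψ ‖u s p‖ 0
        rwa [h0, sub_zero, sub_zero, abs_of_nonneg (norm_nonneg (u s p))] at this
      have h2 := abs_re_mul_conj_div_norm_le (u s p) (ut s p)
      rw [norm_mul, Real.norm_eq_abs, Real.norm_eq_abs]
      refine (mul_le_of_le_one_left (abs_nonneg _) (hη1 p)).trans ?_
      rw [radialDeriv, abs_mul]
      calc _ ≤ k * ‖u s p‖ * ‖ut s p‖ := by gcongr
        _ = k * (‖u s p‖ * ‖ut s p‖) := by ring
        _ ≤ k * (‖u s p‖ ^ 2 + ‖ut s p‖ ^ 2) := by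
          gcongr
          nlinarith [sq_nonneg (‖u s p‖ - ‖ut s p‖), sq_nonneg (‖u s p‖), sq_nonneg (‖ut s p‖)]
  exact ⟨hint, (intervalIntegral.integral_eq_sub_of_hasDerivAt_of_le ht hcont hder hint).symm⟩

end Functional

/-! ### The chain rule for nonnegative radial slopes -/

section MonotoneLimit

variable {Ω : Type*} [MeasurableSpace Ω] {ν : Measure Ω}

/-- The chain rule for `v ↦ ∫ ∫₀^|v| ψ` along a `C¹` curve in `L²`, for a nonnegative lower
semicontinuous `ψ` without growth restriction. -/
theorem integral_radial_sub_eq_integral {ψ : ℝ → ℝ} (hψ : ∀ r, 0 ≤ ψ r) (h0 : ψ 0 = 0)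
    (hlsc : ∀ r, LowerSemicontinuousAt ψ r) (hi : ∀ a b, IntervalIntegrable ψ volume a b)
    {u ut : ℝ → Lp ℂ 2 ν} {t : ℝ} (ht : 0 ≤ t)
    (hu : ContinuousOn u (Icc 0 t)) (hut : ContinuousOn ut (Icc 0 t))
    (hd : ∀ s ∈ Ioo 0 t, HasDerivAt u (ut s) s)
    {κ : ℝ → ℝ} (hκ : IntervalIntegrable κ volume 0 t)
    (hbound : ∀ᵐ s ∂volume, s ∈ Ioc 0 t → Integrable (fun p => ψ ‖u s p‖ * ‖ut s p‖) ν ∧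
      ∫ p, ψ ‖u s p‖ * ‖ut s p‖ ∂ν ≤ κ s) :
    Integrable (fun p => ∫ r in ‖u 0 p‖..‖u t p‖, ψ r) ν ∧
    IntervalIntegrable (fun s => ∫ p, radialDeriv ψ (u s p) (ut s p) ∂ν) volume 0 t ∧
    ∫ p, (∫ r in ‖u 0 p‖..‖u t p‖, ψ r) ∂ν
      = ∫ s in (0 : ℝ)..t, ∫ p, radialDeriv ψ (u s p) (ut s p) ∂ν := by
  set ψk : ℕ → ℝ → ℝ := fun k => lipschitzMinorant ψ k with hψk
  have kn : ∀ k : ℕ, (0 : ℝ) ≤ k := fun k => k.cast_nonneg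
  have nn : ∀ k r, 0 ≤ ψk k r := fun k r => lipschitzMinorant_nonneg hψ k r
  have le : ∀ k r, ψk k r ≤ ψ r := fun k r => lipschitzMinorant_le hψ k r
  have lip : ∀ (k : ℕ) (r r' : ℝ), |ψk k r - ψk k r'| ≤ k * |r - r'| := fun k r r' =>
    lipschitzMinorant_sub_le hψ k r r'
  have z : ∀ k, ψk k 0 = 0 := fun k => le_antisymm ((le k 0).trans_eq h0) (nn k 0)
  have lim : ∀ r, Tendsto (fun k => ψk k r) atTop (𝓝 (ψ r)) := fun r =>
    tendsto_lipschitzMinorant hψ (hlsc r)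
  have cont : ∀ k, Continuous (ψk k) := fun k => continuous_of_abs_sub_le (kn k) (lip k)
  have ii : ∀ k a b, IntervalIntegrable (ψk k) volume a b := fun k a b =>
    (cont k).intervalIntegrable a b
  set D : ℕ → Ω → ℝ := fun k p => ∫ r in ‖u 0 p‖..‖u t p‖, ψk k r with hD
  set G : Ω → ℝ := fun p => ∫ r in ‖u 0 p‖..‖u t p‖, ψ r with hG
  have hDlim : ∀ p, Tendsto (fun k => D k p) atTop (𝓝 (G p)) := fun p =>
    intervalIntegral.tendsto_integral_filter_of_dominated_convergence ψ
      (Eventually.of_forall fun k => (cont k).aestronglyMeasurable)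
      (Eventually.of_forall fun k => Eventually.of_forall fun r _ => by
        rw [Real.norm_of_nonneg (nn k r)]; exact le k r)
      (hi _ _) (Eventually.of_forall fun r _ => lim r)
  have hDle : ∀ k p, ‖D k p‖ ≤ |G p| := fun k p =>
    intervalIntegral.norm_integral_le_abs_of_norm_le
      (Eventually.of_forall fun r => by rw [Real.norm_of_nonneg (nn k r)]; exact le k r) (hi _ _)
  have rep : ∀ (η : Ω → ℝ) (_ : Measurable η) (_ : ∀ p, |η p| ≤ 1) (k : ℕ),
      Integrable (fun p => η p * D k p) ν ∧
      radialFunctional η (ψk k) (u t) - radialFunctional η (ψk k) (u 0)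
        = ∫ p, η p * D k p ∂ν := by
    intro η hη hη1 k
    have i1 := integrable_radialFunctional hη hη1 (kn k) (lip k) (z k) (u t)
    have i0 := integrable_radialFunctional hη hη1 (kn k) (lip k) (z k) (u 0)
    have e : (fun p => η p * D k p) = fun p => η p * (∫ r in (0 : ℝ)..‖u t p‖, ψk k r)
        - η p * (∫ r in (0 : ℝ)..‖u 0 p‖, ψk k r) := by
      funext p
      rw [← mul_sub, intervalIntegral.integral_interval_sub_left (ii k _ _) (ii k _ _)]
    refine ⟨e ▸ i1.sub i0, ?_⟩
    rw [e, integral_sub i1 i0]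
    rfl
  set C := ∫ s in (0 : ℝ)..t, κ s with hC
  have hDint : ∀ k, Integrable (D k) ν := fun k => by
    simpa using (rep (fun _ => 1) measurable_const (fun _ => by simp) k).1
  have hDC : ∀ k, ∫ p, ‖D k p‖ ∂ν ≤ C := by
    intro k
    -- As ψₖ ≥ 0, the sign of D k p is that of ‖u t p‖ − ‖u 0 p‖, independently of k. The weight η
    -- turns D k into its absolute value, and the fundamental theorem of calculus then bounds its L¹
    -- norm by ∫κ.
    set η : Ω → ℝ := fun p => if ‖u 0 p‖ ≤ ‖u t p‖ then 1 else -1 with hη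
    have hηm : Measurable η := Measurable.ite
      (measurableSet_le (Lp.stronglyMeasurable (u 0)).measurable.norm
        (Lp.stronglyMeasurable (u t)).measurable.norm) measurable_const measurable_const
    have hη1 : ∀ p, |η p| ≤ 1 := fun p => by
      rw [hη]; dsimp only; split_ifs <;> simp
    have e : (fun p => ‖D k p‖) = fun p => η p * D k p := by
      funext p
      rw [hη]
      dsimp only
      split_ifs with h
      · rw [one_mul, Real.norm_of_nonneg (intervalIntegral.integral_nonneg h fun r _ => nn k r)]
      · rw [neg_one_mul, Real.norm_of_nonpos]
        rw [hD]
        dsimp only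
        rw [intervalIntegral.integral_symm]
        exact neg_nonpos.2 (intervalIntegral.integral_nonneg (not_le.1 h).le fun r _ => nn k r)
    have ftc := radialFunctional_sub_eq_integral hηm hη1 (kn k) (lip k) (z k) ht hu hut hd
    rw [e, ← (rep η hηm hη1 k).2, ftc.2]
    refine intervalIntegral.integral_mono_ae_restrict ht ftc.1 hκ ?_
    rw [EventuallyLE, ← restrict_Ioc_eq_restrict_Icc, ae_restrict_iff' measurableSet_Ioc]
    filter_upwards [hbound] with s hs hst
    obtain ⟨hs1, hs2⟩ := hs hst
    refine (Real.le_norm_self _).trans ((norm_integral_le_of_norm_le hs1 ?_).trans hs2)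
    refine Eventually.of_forall fun p => ?_
    rw [norm_mul, Real.norm_eq_abs, Real.norm_eq_abs]
    refine (mul_le_of_le_one_left (abs_nonneg _) (hη1 p)).trans
      ((abs_radialDeriv_le (nn k) _ _).trans ?_)
    exact mul_le_mul_of_nonneg_right (le k _) (norm_nonneg _)
  have hGm : AEStronglyMeasurable G ν :=
    aestronglyMeasurable_of_tendsto_ae atTop (fun k => (hDint k).1)
      (Eventually.of_forall hDlim)
  -- Fatou's lemma, with the bound C on the L¹ norms uniform in k. Once G is integrable it dominates
  -- all D k.
  have hGi : Integrable G ν := by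
    refine ⟨hGm, ?_⟩
    have hle : ∫⁻ p, ‖G p‖ₑ ∂ν ≤ liminf (fun k => ∫⁻ p, ‖D k p‖ₑ ∂ν) atTop := by
      have e : ∀ p, ‖G p‖ₑ = liminf (fun k => ‖D k p‖ₑ) atTop := fun p =>
        ((hDlim p).enorm).liminf_eq.symm
      simp only [e]
      exact lintegral_liminf_le' fun k => (hDint k).1.enorm
    refine hle.trans_lt (lt_of_le_of_lt ?_ (ENNReal.ofReal_lt_top (r := C)))
    refine liminf_le_of_le (by isBoundedDefault) fun b hb => ?_
    obtain ⟨k, hk⟩ := hb.exists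
    refine hk.trans ?_
    rw [← ofReal_integral_norm_eq_lintegral_enorm (hDint k)]
    exact ENNReal.ofReal_le_ofReal (hDC k)
  have lim₁ : Tendsto (fun k => ∫ p, D k p ∂ν) atTop (𝓝 (∫ p, G p ∂ν)) :=
    tendsto_integral_of_dominated_convergence (fun p => |G p|) (fun k => (hDint k).1) hGi.abs
      (fun k => Eventually.of_forall (hDle k)) (Eventually.of_forall hDlim)
  have ftc := fun k => radialFunctional_sub_eq_integral (ν := ν) (η := fun _ => 1)
    measurable_const (fun _ => by simp) (kn k) (lip k) (z k) ht hu hut hd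
  have eD : ∀ k, ∫ p, D k p ∂ν =
      ∫ s in (0 : ℝ)..t, ∫ p, radialDeriv (ψk k) (u s p) (ut s p) ∂ν := by
    intro k
    have h1 := (rep (fun _ => 1) measurable_const (fun _ => by simp) k).2
    simp only [one_mul] at h1
    rw [← h1, (ftc k).2]
    simp only [one_mul]
  have ftci : ∀ k, IntervalIntegrable
      (fun s => ∫ p, radialDeriv (ψk k) (u s p) (ut s p) ∂ν) volume 0 t := fun k => by
    simpa only [one_mul] using (ftc k).1
  have hlims : ∀ᵐ s ∂volume, s ∈ Ioc 0 t → Tendsto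
      (fun k => ∫ p, radialDeriv (ψk k) (u s p) (ut s p) ∂ν) atTop
      (𝓝 (∫ p, radialDeriv ψ (u s p) (ut s p) ∂ν)) := by
    filter_upwards [hbound] with s hs hst
    refine tendsto_integral_of_dominated_convergence _ (fun k => ?_) (hs hst).1
      (fun k => Eventually.of_forall fun p => ?_) (Eventually.of_forall fun p => ?_)
    · simpa using (integrable_mul_radialDeriv (ν := ν) (η := fun _ => 1) measurable_const
        (fun _ => by simp) (kn k) (lip k) (z k) (u s) (ut s)).1
    · exact (abs_radialDeriv_le (nn k) _ _).trans
        (mul_le_mul_of_nonneg_right (le k _) (norm_nonneg _))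
    · exact (lim _).mul_const _
  have hbd : ∀ k, ∀ᵐ s ∂volume, s ∈ Ioc 0 t →
      ‖∫ p, radialDeriv (ψk k) (u s p) (ut s p) ∂ν‖ ≤ κ s := by
    intro k
    filter_upwards [hbound] with s hs hst
    obtain ⟨hs1, hs2⟩ := hs hst
    refine (norm_integral_le_of_norm_le hs1 (Eventually.of_forall fun p => ?_)).trans hs2
    exact (abs_radialDeriv_le (nn k) _ _).trans
      (mul_le_mul_of_nonneg_right (le k _) (norm_nonneg _))
  have hlimi : IntervalIntegrable (fun s => ∫ p, radialDeriv ψ (u s p) (ut s p) ∂ν) volume 0 t := by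
    rw [intervalIntegrable_iff_integrableOn_Ioc_of_le ht] at hκ ⊢
    refine Integrable.mono' hκ (aestronglyMeasurable_of_tendsto_ae atTop
      (f := fun k s => ∫ p, radialDeriv (ψk k) (u s p) (ut s p) ∂ν) (fun k => ?_) ?_) ?_
    · exact ((intervalIntegrable_iff_integrableOn_Ioc_of_le ht).1 (ftci k)).1
    · exact (ae_restrict_iff' measurableSet_Ioc).2 hlims
    · rw [ae_restrict_iff' measurableSet_Ioc]
      filter_upwards [hlims, ae_all_iff.2 hbd] with s h1 h2 hst
      exact le_of_tendsto (h1 hst).norm (Eventually.of_forall fun k => h2 k hst)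
  refine ⟨hGi, hlimi, ?_⟩
  refine tendsto_nhds_unique lim₁ ?_
  simp only [eD]
  refine intervalIntegral.tendsto_integral_filter_of_dominated_convergence κ
    (Eventually.of_forall fun k => ?_) (Eventually.of_forall fun k => ?_) hκ ?_
  · rw [uIoc_of_le ht]
    exact ((intervalIntegrable_iff_integrableOn_Ioc_of_le ht).1 (ftci k)).1
  · rw [uIoc_of_le ht]
    exact hbd k
  · rw [uIoc_of_le ht]
    exact hlims

end MonotoneLimit

/-! ### The chain rule for the potential energy -/

section ChainRule

/-- The restriction of a continuous function to `(0, ∞)`, extended by zero. -/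
noncomputable def positiveCut (h : ℝ → ℝ) : ℝ → ℝ := (Ioi 0).indicator h

/-- The only possible jump is at 0, where the value taken is 0, the lower one. -/
theorem lowerSemicontinuousAt_positiveCut {h : ℝ → ℝ} (hc : Continuous h) (hn : ∀ r, 0 ≤ h r)
    (r : ℝ) : LowerSemicontinuousAt (positiveCut h) r := by
  intro y hy
  by_cases hr : 0 < r
  · have e : positiveCut h r = h r := indicator_of_mem (mem_Ioi.2 hr) h
    rw [e] at hy
    filter_upwards [hc.continuousAt.eventually (lt_mem_nhds hy), lt_mem_nhds hr] with x hx hx0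
    have e' : positiveCut h x = h x := indicator_of_mem (mem_Ioi.2 hx0) h
    rwa [e']
  · have e : positiveCut h r = 0 := indicator_of_notMem (by simpa using hr) h
    rw [e] at hy
    exact Eventually.of_forall fun x => hy.trans_le (indicator_nonneg (fun x _ => hn x) x)

theorem intervalIntegrable_positiveCut {h : ℝ → ℝ} (hc : Continuous h) (a b : ℝ) :
    IntervalIntegrable (positiveCut h) volume a b := by
  have := hc.intervalIntegrable (μ := volume) a b
  rw [intervalIntegrable_iff] at this ⊢
  exact this.indicator measurableSet_Ioi

theorem integral_positiveCut {h : ℝ → ℝ} {a b : ℝ} (ha : 0 ≤ a) (hb : 0 ≤ b) :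
    ∫ r in a..b, positiveCut h r = ∫ r in a..b, h r := by
  refine intervalIntegral.integral_congr_ae (Eventually.of_forall fun r hr => ?_)
  have : 0 < r := by
    rcases le_total a b with hab | hab
    · rw [uIoc_of_le hab] at hr; exact ha.trans_lt hr.1
    · rw [uIoc_of_ge hab] at hr; exact hb.trans_lt hr.1
  exact indicator_of_mem (mem_Ioi.2 this) h

variable {g : ℝ → ℝ}

/-- The derivative of `g` on `[0, ∞)`, extended continuously to the negative axis. -/
noncomputable def radialSlope (g : ℝ → ℝ) (r : ℝ) : ℝ := derivWithin g (Ici 0) (max r 0)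

theorem radialSlope_of_pos {r : ℝ} (hr : 0 < r) : radialSlope g r = deriv g r := by
  rw [radialSlope, max_eq_left hr.le]
  exact derivWithin_of_mem_nhds (Ici_mem_nhds hr)

/-- The two-sided derivative at 0 depends on g at negative arguments, but there the factor z
vanishes; elsewhere it agrees with the one-sided derivative. -/
theorem nonlinearity_eq_radialSlope (z : ℂ) :
    nonlinearity g z = ((radialSlope g ‖z‖ / ‖z‖ : ℝ) : ℂ) * z := by
  rcases eq_or_ne z 0 with rfl | hz
  · simp [nonlinearity]
  · rw [nonlinearity, radialSlope_of_pos (norm_pos_iff.2 hz)]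
    push_cast
    ring

variable (hg : ContDiffOn ℝ 1 g (Ici 0))
include hg

theorem continuous_radialSlope : Continuous (radialSlope g) := by
  have := hg.continuousOn_derivWithin (uniqueDiffOn_Ici 0) le_rfl
  exact this.comp_continuous (continuous_id.max continuous_const)
    fun r => mem_Ici.2 (le_max_right r 0)

theorem integral_radialSlope {a b : ℝ} (ha : 0 ≤ a) (hb : 0 ≤ b) :
    ∫ r in a..b, radialSlope g r = g b - g a := by
  have hsub : uIcc a b ⊆ Ici 0 := fun x hx => (le_min ha hb).trans hx.1
  refine intervalIntegral.integral_eq_sub_of_hasDeriv_right (hg.continuousOn.mono hsub)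
    (fun x hx => ?_) ((continuous_radialSlope hg).intervalIntegrable _ _)
  have hx0 : 0 < x := (le_min ha hb).trans_lt hx.1
  rw [radialSlope_of_pos hx0]
  exact ((hg.differentiableOn one_ne_zero).differentiableAt
    (Ici_mem_nhds hx0)).hasDerivAt.hasDerivWithinAt

variable {Ω : Type*} [MeasurableSpace Ω] {ν : Measure Ω}

/-- The chain rule for the potential energy along a `C¹` curve in `L²`. -/
theorem integral_potential_sub_eq_integral {u ut : ℝ → Lp ℂ 2 ν} {t : ℝ} (ht : 0 ≤ t)
    (hu : ContinuousOn u (Icc 0 t)) (hut : ContinuousOn ut (Icc 0 t))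
    (hd : ∀ s ∈ Ioo 0 t, HasDerivAt u (ut s) s)
    {κ : ℝ → ℝ} (hκ : IntervalIntegrable κ volume 0 t)
    (hbound : ∀ᵐ s ∂volume, s ∈ Ioc 0 t →
      Integrable (fun p => nonlinearity g (u s p) * conj (ut s p)) ν ∧
      ∫ p, ‖nonlinearity g (u s p) * conj (ut s p)‖ ∂ν ≤ κ s) :
    Integrable (fun p => potential g (u t p) - potential g (u 0 p)) ν ∧
    IntervalIntegrable (fun s => (∫ p, nonlinearity g (u s p) * conj (ut s p) ∂ν).re)
      volume 0 t ∧
    ∫ p, (potential g (u t p) - potential g (u 0 p)) ∂ν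
      = ∫ s in (0 : ℝ)..t, (∫ p, nonlinearity g (u s p) * conj (ut s p) ∂ν).re := by
  have hc := continuous_radialSlope hg
  set h := radialSlope g with hh
  have hpc : Continuous fun r => max (h r) 0 := hc.max continuous_const
  have hnc : Continuous fun r => max (-h r) 0 := hc.neg.max continuous_const
  -- The one-sided slope g'(0) may be nonzero, whereas f(0) = 0 and the Lipschitz theory needs ψ(0)
  -- = 0. Cutting at 0 achieves this and leaves the integrals over [0, ∞) unchanged.
  set P := positiveCut fun r => max (h r) 0 with hP
  set N := positiveCut fun r => max (-h r) 0 with hN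
  have hP0 : ∀ r, 0 ≤ P r := fun r => indicator_nonneg (fun _ _ => le_max_right _ _) r
  have hN0 : ∀ r, 0 ≤ N r := fun r => indicator_nonneg (fun _ _ => le_max_right _ _) r
  have hnorm : ∀ z w : ℂ, z ≠ 0 → ‖nonlinearity g z * conj w‖ = |h ‖z‖| * ‖w‖ := by
    intro z w hz
    rw [nonlinearity_eq_radialSlope, norm_mul, norm_mul, Complex.norm_real, RCLike.norm_conj,
      Real.norm_eq_abs, abs_div, abs_norm, div_mul_cancel₀ _ (norm_ne_zero_iff.2 hz)]
  have hPle : ∀ z w : ℂ, P ‖z‖ * ‖w‖ ≤ ‖nonlinearity g z * conj w‖ := by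
    intro z w
    rcases eq_or_ne z 0 with rfl | hz
    · simpa [hP, positiveCut] using mul_nonneg (norm_nonneg (nonlinearity g 0)) (norm_nonneg w)
    · rw [hnorm z w hz, hP, positiveCut, indicator_of_mem (mem_Ioi.2 (norm_pos_iff.2 hz))]
      exact mul_le_mul_of_nonneg_right (max_le (le_abs_self _) (abs_nonneg _)) (norm_nonneg _)
  have hNle : ∀ z w : ℂ, N ‖z‖ * ‖w‖ ≤ ‖nonlinearity g z * conj w‖ := by
    intro z w
    rcases eq_or_ne z 0 with rfl | hz
    · simpa [hN, positiveCut] using mul_nonneg (norm_nonneg (nonlinearity g 0)) (norm_nonneg w)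
    · rw [hnorm z w hz, hN, positiveCut, indicator_of_mem (mem_Ioi.2 (norm_pos_iff.2 hz))]
      exact mul_le_mul_of_nonneg_right (max_le (neg_le_abs _) (abs_nonneg _)) (norm_nonneg _)
  have hsplit : ∀ z w : ℂ, (nonlinearity g z * conj w).re =
      radialDeriv P z w - radialDeriv N z w := by
    intro z w
    rcases eq_or_ne z 0 with rfl | hz
    · simp [nonlinearity, radialDeriv]
    · rw [nonlinearity_eq_radialSlope, mul_assoc, Complex.re_ofReal_mul, radialDeriv, radialDeriv,
        hP, hN, positiveCut, positiveCut, indicator_of_mem (mem_Ioi.2 (norm_pos_iff.2 hz)),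
        indicator_of_mem (mem_Ioi.2 (norm_pos_iff.2 hz)), ← sub_mul,
        max_zero_sub_max_neg_zero_eq_self (h ‖z‖)]
      ring
  have meas : ∀ {φ : ℝ → ℝ}, Continuous φ → ∀ v w : Lp ℂ 2 ν,
      AEStronglyMeasurable (fun p => positiveCut φ ‖v p‖ * ‖w p‖) ν := by
    intro φ hφ v w
    have h1 : Measurable (positiveCut φ) := hφ.measurable.indicator measurableSet_Ioi
    exact ((h1.comp (Lp.stronglyMeasurable v).measurable.norm).mul
      (Lp.stronglyMeasurable w).measurable.norm).aestronglyMeasurable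
  have bound : ∀ {φ : ℝ → ℝ}, Continuous φ → (∀ r, 0 ≤ positiveCut φ r) →
      (∀ z w : ℂ, positiveCut φ ‖z‖ * ‖w‖ ≤ ‖nonlinearity g z * conj w‖) →
      ∀ᵐ s ∂volume, s ∈ Ioc 0 t → Integrable (fun p => positiveCut φ ‖u s p‖ * ‖ut s p‖) ν ∧
      ∫ p, positiveCut φ ‖u s p‖ * ‖ut s p‖ ∂ν ≤ κ s := by
    intro φ hφ hφ0 hle
    filter_upwards [hbound] with s hs hst
    obtain ⟨hs1, hs2⟩ := hs hst
    have hi : Integrable (fun p => positiveCut φ ‖u s p‖ * ‖ut s p‖) ν := by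
      refine hs1.norm.mono' (meas hφ _ _) (Eventually.of_forall fun p => ?_)
      rw [Real.norm_of_nonneg (mul_nonneg (hφ0 _) (norm_nonneg _))]
      exact hle _ _
    exact ⟨hi, (integral_mono hi hs1.norm fun p => hle _ _).trans hs2⟩
  have bP := bound hpc hP0 hPle
  have bN := bound hnc hN0 hNle
  obtain ⟨p1, p2, p3⟩ := integral_radial_sub_eq_integral hP0 (by simp [hP, positiveCut])
    (lowerSemicontinuousAt_positiveCut hpc fun r => le_max_right _ _)
    (intervalIntegrable_positiveCut hpc) ht hu hut hd hκ bP
  obtain ⟨n1, n2, n3⟩ := integral_radial_sub_eq_integral hN0 (by simp [hN, positiveCut])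
    (lowerSemicontinuousAt_positiveCut hnc fun r => le_max_right _ _)
    (intervalIntegrable_positiveCut hnc) ht hu hut hd hκ bN
  have eF : (fun p => potential g (u t p) - potential g (u 0 p)) = fun p =>
      (∫ r in ‖u 0 p‖..‖u t p‖, P r) - ∫ r in ‖u 0 p‖..‖u t p‖, N r := by
    funext p
    rw [hP, hN, integral_positiveCut (norm_nonneg _) (norm_nonneg _),
      integral_positiveCut (norm_nonneg _) (norm_nonneg _),
      ← intervalIntegral.integral_sub (hpc.intervalIntegrable _ _) (hnc.intervalIntegrable _ _),
      potential, potential, ← integral_radialSlope hg (norm_nonneg _) (norm_nonneg _)]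
    refine intervalIntegral.integral_congr fun r _ => ?_
    exact (max_zero_sub_max_neg_zero_eq_self (h r)).symm
  have eR : ∀ᵐ s ∂volume, s ∈ Ioc 0 t →
      (∫ p, radialDeriv P (u s p) (ut s p) ∂ν) - ∫ p, radialDeriv N (u s p) (ut s p) ∂ν
        = (∫ p, nonlinearity g (u s p) * conj (ut s p) ∂ν).re := by
    filter_upwards [bP, bN, hbound] with s h1 h2 h3 hst
    have mR : ∀ {φ : ℝ → ℝ}, Continuous φ →
        AEStronglyMeasurable (fun p => radialDeriv (positiveCut φ) (u s p) (ut s p)) ν := by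
      intro φ hφ
      have m1 : Measurable (positiveCut φ) := hφ.measurable.indicator measurableSet_Ioi
      have mu := (Lp.stronglyMeasurable (u s)).measurable
      have mv := (Lp.stronglyMeasurable (ut s)).measurable
      exact ((m1.comp mu.norm).mul ((Complex.measurable_re.comp
        (mu.mul (Complex.continuous_conj.measurable.comp mv))).div mu.norm)).aestronglyMeasurable
    have i1 : Integrable (fun p => radialDeriv P (u s p) (ut s p)) ν :=
      (h1 hst).1.mono' (mR hpc) (Eventually.of_forall fun p => abs_radialDeriv_le hP0 _ _)
    have i2 : Integrable (fun p => radialDeriv N (u s p) (ut s p)) ν :=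
      (h2 hst).1.mono' (mR hnc) (Eventually.of_forall fun p => abs_radialDeriv_le hN0 _ _)
    rw [← integral_sub i1 i2, ← RCLike.re_to_complex, ← integral_re (h3 hst).1]
    exact integral_congr_ae (Eventually.of_forall fun p => (hsplit _ _).symm)
  refine ⟨eF ▸ p1.sub n1, ?_, ?_⟩
  · refine (p2.sub n2).congr_ae ?_
    rw [uIoc_of_le ht]
    exact (ae_restrict_iff' measurableSet_Ioc).2 eR
  · rw [eF, integral_sub p1 n1, p3, n3, ← intervalIntegral.integral_sub p2 n2]
    refine intervalIntegral.integral_congr_ae ?_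
    rw [uIoc_of_le ht]
    exact eR

end ChainRule

/-! ### The concavity argument -/

section Concavity

/-- Continuous induction: at the first point where φ ≤ 0, positivity before it would force
positivity there. -/
theorem pos_of_pos_on_initial_segment {φ : ℝ → ℝ} {T : ℝ} (hφ : ContinuousOn φ (Ico 0 T))
    (h : ∀ t ∈ Ico 0 T, (∀ s ∈ Ico 0 t, 0 < φ s) → 0 < φ t) : ∀ t ∈ Ico 0 T, 0 < φ t := by
  intro t ht
  by_contra hneg
  set A : Set ℝ := Icc 0 t ∩ φ ⁻¹' Iic 0 with hA
  have hAc : IsClosed A :=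
    (hφ.mono (Icc_subset_Ico_right ht.2)).preimage_isClosed_of_isClosed isClosed_Icc isClosed_Iic
  have hAn : A.Nonempty := ⟨t, ⟨ht.1, le_rfl⟩, not_lt.1 hneg⟩
  have hAb : BddBelow A := ⟨0, fun x hx => hx.1.1⟩
  have hτ := hAc.csInf_mem hAn hAb
  refine absurd (h (sInf A) ⟨hτ.1.1, hτ.1.2.trans_lt ht.2⟩ fun s hs => ?_) (not_lt.2 hτ.2)
  by_contra hs'
  exact absurd (csInf_le hAb ⟨⟨hs.1, hs.2.le.trans hτ.1.2⟩, not_lt.1 hs'⟩) (not_le.2 hs.2)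

/-- The concavity method: if `P > 0` satisfies `P P'' ≥ (1 + γ) P'²` in integrated form and
`P'(0) > 0`, then `P` cannot live beyond `P(0) / (γ P'(0))`. -/
theorem le_of_concavity {P p : ℝ → ℝ} {T γ : ℝ} (hT : 0 < T) (hγ : 0 < γ)
    (hPc : ContinuousOn P (Ico 0 T)) (hd : ∀ t ∈ Ioo 0 T, HasDerivAt P (p t) t)
    (hp : ContinuousOn p (Ico 0 T)) (hP : ∀ t ∈ Ico 0 T, 0 < P t) (hp0 : 0 < p 0)
    (hineq : ∀ t ∈ Ico 0 T, (∫ s in (0 : ℝ)..t, (1 + γ) * (p s ^ 2 / P s)) ≤ p t - p 0) :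
    T ≤ P 0 / (γ * p 0) := by
  have h0 : (0 : ℝ) ∈ Ico 0 T := ⟨le_rfl, hT⟩
  have hP0 := hP 0 h0
  have hpow : ∀ e : ℝ, ContinuousOn (fun t => P t ^ e) (Ico 0 T) := fun e =>
    hPc.rpow_const fun t ht => Or.inl (hP t ht).ne'
  have hpowd : ∀ e : ℝ, ∀ t ∈ Ioo 0 T, HasDerivAt (fun t => P t ^ e)
      (p t * e * P t ^ (e - 1)) t := fun e t ht =>
    (hd t ht).rpow_const (Or.inl (hP t ⟨ht.1.le, ht.2⟩).ne')
  set a := p 0 / P 0 ^ (1 + γ) with ha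
  have ha0 : 0 < a := div_pos hp0 (Real.rpow_pos_of_pos hP0 _)
  -- Formally p P^(−1−γ) is nondecreasing, so p ≥ aP^(1+γ). Since p need not be differentiable, the
  -- comparison is made on integrals. Taking a' < a makes it strict at time 0, so that continuous
  -- induction applies.
  have key : ∀ a', 0 < a' → a' < a → ∀ t ∈ Ico 0 T, γ * a' * t ≤ P 0 ^ (-γ) := by
    intro a' ha' haa t ht
    have hφ : ∀ t ∈ Ico 0 T, 0 < p t - a' * P t ^ (1 + γ) := by
      refine pos_of_pos_on_initial_segment (hp.sub (continuousOn_const.mul (hpow _))) ?_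
      intro t ht hpos
      have hsub : Icc 0 t ⊆ Ico 0 T := Icc_subset_Ico_right ht.2
      have hstart : 0 < p 0 - a' * P 0 ^ (1 + γ) := by
        rw [sub_pos]
        rwa [ha, lt_div_iff₀ (Real.rpow_pos_of_pos hP0 _)] at haa
      have hci : ContinuousOn (fun s => p s * (1 + γ) * P s ^ γ) (Icc 0 t) :=
        ((hp.mul continuousOn_const).mul (hpow γ)).mono hsub
      have hci2 : ContinuousOn (fun s => (1 + γ) * (p s ^ 2 / P s)) (Icc 0 t) :=
        (continuousOn_const.mul ((hp.pow 2).div hPc fun s hs => (hP s hs).ne')).mono hsub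
      have ii1 : IntervalIntegrable (fun s => p s * (1 + γ) * P s ^ γ) volume 0 t :=
        hci.intervalIntegrable_of_Icc ht.1
      have ii2 : IntervalIntegrable (fun s => (1 + γ) * (p s ^ 2 / P s)) volume 0 t :=
        hci2.intervalIntegrable_of_Icc ht.1
      have hftc : ∫ s in (0 : ℝ)..t, p s * (1 + γ) * P s ^ γ = P t ^ (1 + γ) - P 0 ^ (1 + γ) := by
        refine intervalIntegral.integral_eq_sub_of_hasDerivAt_of_le ht.1 ((hpow (1 + γ)).mono hsub)
          (fun s hs => ?_) ii1
        have := hpowd (1 + γ) s ⟨hs.1, hs.2.trans ht.2⟩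
        rwa [add_sub_cancel_left] at this
      have hmono : 0 ≤ ∫ s in (0 : ℝ)..t,
          ((1 + γ) * (p s ^ 2 / P s) - a' * (p s * (1 + γ) * P s ^ γ)) := by
        refine intervalIntegral.integral_nonneg_of_ae_restrict ht.1 ?_
        rw [EventuallyLE, ← restrict_Ico_eq_restrict_Icc, ae_restrict_iff' measurableSet_Ico]
        refine Eventually.of_forall fun s hs => ?_
        have hPs := hP s ⟨hs.1, hs.2.trans ht.2⟩
        have hφs := hpos s hs
        have hps : 0 < p s := by
          have := mul_pos ha' (Real.rpow_pos_of_pos hPs (1 + γ))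
          linarith
        have e : (1 + γ) * (p s ^ 2 / P s) - a' * (p s * (1 + γ) * P s ^ γ)
            = (1 + γ) * (p s / P s) * (p s - a' * P s ^ (1 + γ)) := by
          rw [Real.rpow_add hPs, Real.rpow_one]
          field_simp
        rw [Pi.zero_apply, e]
        positivity
      rw [intervalIntegral.integral_sub ii2 (ii1.const_mul a'),
        intervalIntegral.integral_const_mul a',
        hftc] at hmono
      have := hineq t ht
      linarith
    -- The derivative of P^(−γ) is −γ p P^(−γ−1), at most −γa' by the comparison just proved.
    have hanti : AntitoneOn (fun t => P t ^ (-γ) + γ * a' * t) (Ico 0 T) := by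
      have hder : ∀ t ∈ Ioo 0 T, HasDerivAt (fun t => P t ^ (-γ) + γ * a' * t)
          (p t * (-γ) * P t ^ (-γ - 1) + γ * a' * 1) t := fun t ht =>
        (hpowd (-γ) t ht).add ((hasDerivAt_id t).const_mul _)
      refine antitoneOn_of_deriv_nonpos (convex_Ico 0 T)
        ((hpow (-γ)).add (continuousOn_const.mul continuousOn_id)) ?_ ?_
      · rw [interior_Ico]
        exact fun t ht => (hder t ht).differentiableAt.differentiableWithinAt
      · rw [interior_Ico]
        intro t ht
        rw [(hder t ht).deriv]
        have hPt := hP t ⟨ht.1.le, ht.2⟩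
        have h1 := hφ t ⟨ht.1.le, ht.2⟩
        have h2 : P t ^ (-γ - 1) * P t ^ (1 + γ) = 1 := by
          rw [← Real.rpow_add hPt, show -γ - 1 + (1 + γ) = 0 by ring, Real.rpow_zero]
        have h3 : 0 < P t ^ (-γ - 1) := Real.rpow_pos_of_pos hPt _
        have h4 : a' ≤ p t * P t ^ (-γ - 1) := by
          have := mul_le_mul_of_nonneg_left (sub_pos.1 h1).le h3.le
          calc a' = P t ^ (-γ - 1) * (a' * P t ^ (1 + γ)) := by
                rw [mul_left_comm, h2, mul_one]
            _ ≤ P t ^ (-γ - 1) * p t := this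
            _ = _ := mul_comm _ _
        nlinarith
    have := hanti h0 ht ht.1
    simp only [mul_zero, add_zero] at this
    have h3 : 0 < P t ^ (-γ) := Real.rpow_pos_of_pos (hP t ht) _
    linarith
  have key2 : ∀ t ∈ Ico 0 T, γ * a * t ≤ P 0 ^ (-γ) := by
    intro t ht
    have hl : Tendsto (fun a' => γ * a' * t) (𝓝[<] a) (𝓝 (γ * a * t)) :=
      (Continuous.tendsto (by fun_prop : Continuous fun a' => γ * a' * t) a).mono_left
        nhdsWithin_le_nhds
    refine le_of_tendsto hl ?_
    filter_upwards [Ioo_mem_nhdsLT ha0] with a' h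
    exact key a' h.1 h.2 t ht
  have key3 : γ * a * T ≤ P 0 ^ (-γ) := by
    have hl : Tendsto (fun t => γ * a * t) (𝓝[<] T) (𝓝 (γ * a * T)) :=
      (Continuous.tendsto (by fun_prop : Continuous fun t => γ * a * t) T).mono_left
        nhdsWithin_le_nhds
    refine le_of_tendsto hl ?_
    filter_upwards [Ioo_mem_nhdsLT hT] with t h
    exact key2 t ⟨h.1.le, h.2⟩
  rw [le_div_iff₀ (by positivity)]
  have e : γ * a * P 0 ^ (1 + γ) = γ * p 0 := by
    rw [ha]
    have := (Real.rpow_pos_of_pos hP0 (1 + γ)).ne'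
    field_simp
  have e2 : P 0 ^ (-γ) * P 0 ^ (1 + γ) = P 0 := by
    rw [← Real.rpow_add hP0]
    norm_num
  calc T * (γ * p 0) = γ * a * T * P 0 ^ (1 + γ) := by rw [← e]; ring
    _ ≤ P 0 ^ (-γ) * P 0 ^ (1 + γ) := by gcongr
    _ = P 0 := e2

end Concavity

/-! ### Scalar growth inequalities and lifespan bounds -/

section ScalarDynamics

/-- The scalar inequalities on `[0, T)` satisfied by `M = ‖u‖²`, `r = Re (u, u_t)` and
`v = ‖u_t‖²` along a solution with initial energy `e`. -/
structure EnergyDynamics (b m α e : ℝ) (M r v : ℝ → ℝ) (T : ℝ) : Prop where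
  continuousOn_M : ContinuousOn M (Ico 0 T)
  continuousOn_r : ContinuousOn r (Ico 0 T)
  continuousOn_v : ContinuousOn v (Ico 0 T)
  hasDerivAt_M : ∀ t ∈ Ioo 0 T, HasDerivAt M (2 * r t) t
  M_nonneg : ∀ t, 0 ≤ M t
  v_nonneg : ∀ t, 0 ≤ v t
  quadratic_nonneg : ∀ t x, 0 ≤ M t * (x * x) + 2 * r t * x + v t
  increment : ∀ s t, 0 ≤ s → s ≤ t → t < T →
    (∫ σ in s..t, ((α + 2) * v σ + (α - 2) * m * M σ - 2 * α * e
      + 2 * α * b * ∫ τ in (0 : ℝ)..σ, v τ)) ≤ 2 * r t + b * M t - (2 * r s + b * M s)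

namespace EnergyDynamics

variable {b m α μ e : ℝ} {M r v : ℝ → ℝ} {T : ℝ}

theorem continuousOn_primitive {φ : ℝ → ℝ} (hφ : ContinuousOn φ (Ico 0 T)) :
    ContinuousOn (fun t => ∫ s in (0 : ℝ)..t, φ s) (Ico 0 T) := by
  intro t ht
  obtain ⟨S, hS, hST⟩ := exists_between ht.2
  have hS0 : 0 ≤ S := ht.1.trans hS.le
  have hi : IntegrableOn φ (uIcc 0 S) := by
    rw [uIcc_of_le hS0]
    exact (hφ.mono (Icc_subset_Ico_right hST)).integrableOn_Icc
  have := intervalIntegral.continuousOn_primitive_interval hi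
  rw [uIcc_of_le hS0] at this
  refine (this t ⟨ht.1, hS.le⟩).mono_of_mem_nhdsWithin ?_
  filter_upwards [self_mem_nhdsWithin, mem_nhdsWithin_of_mem_nhds (gt_mem_nhds hS)] with x hx hxS
  exact ⟨hx.1, hxS.le⟩

theorem hasDerivAt_primitive {φ : ℝ → ℝ} (hφ : ContinuousOn φ (Ico 0 T)) {t : ℝ}
    (ht : t ∈ Ioo 0 T) : HasDerivAt (fun t => ∫ s in (0 : ℝ)..t, φ s) (φ t) t := by
  refine intervalIntegral.integral_hasDerivAt_right
    ((hφ.mono (Icc_subset_Ico_right ht.2)).intervalIntegrable_of_Icc ht.1.le)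
    ((hφ.mono Ioo_subset_Ico_self).stronglyMeasurableAtFilter isOpen_Ioo t ht)
    ((hφ t ⟨ht.1.le, ht.2⟩).continuousAt (Ico_mem_nhds ht.1 ht.2))

variable (hb : 0 < b) (hm : 0 < m) (hα : 2 < α) (hbμ : b ≤ μ) (hmμ : m ≤ μ)

include hb hm hα hbμ in
/-- The pointwise lower bound that drives the growth of `2 r + b M`. -/
theorem integrand_ge (h : EnergyDynamics b m α e M r v T) (t : ℝ) :
    (α + 2 - m * (α - 2) / (μ + 1)) * v t
      + m * (α - 2) / (μ + 1) * (2 * r t + b * M t - 2 * (α * (μ + 1) / (m * (α - 2)) * e))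
      ≤ (α + 2) * v t + (α - 2) * m * M t - 2 * α * e := by
  have hμ : 0 < μ + 1 := by linarith
  have hα' : 0 < α - 2 := by linarith
  set κ := m * (α - 2) / (μ + 1) with hκd
  have hκ : 0 < κ := by positivity
  have e1 : κ * (2 * (α * (μ + 1) / (m * (α - 2)) * e)) = 2 * α * e := by
    rw [hκd]
    field_simp
  have e2 : (α - 2) * m = κ * (μ + 1) := by
    rw [hκd]
    field_simp
  rw [mul_sub κ, e1, e2]
  -- At x = −1 this reads 2r ≤ M + v; it uses one of the μ + 1 copies of κM, and b ≤ μ uses the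
  -- others.
  have h1 := h.quadratic_nonneg t (-1)
  have h2 := h.M_nonneg t
  have h3 : 0 ≤ κ * (M t + v t - 2 * r t) := by
    apply mul_nonneg hκ.le
    linarith
  have h4 : 0 ≤ κ * ((μ - b) * M t) :=
    mul_nonneg hκ.le (mul_nonneg (by linarith) h2)
  nlinarith

theorem continuousOn_integrand (h : EnergyDynamics b m α e M r v T) :
    ContinuousOn (fun σ => (α + 2) * v σ + (α - 2) * m * M σ - 2 * α * e
      + 2 * α * b * ∫ τ in (0 : ℝ)..σ, v τ) (Ico 0 T) :=
  (((continuousOn_const.mul h.continuousOn_v).add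
    (continuousOn_const.mul h.continuousOn_M)).sub continuousOn_const).add
    (continuousOn_const.mul (continuousOn_primitive h.continuousOn_v))

theorem integral_v_nonneg (h : EnergyDynamics b m α e M r v T) {t : ℝ} (ht : 0 ≤ t) :
    0 ≤ ∫ τ in (0 : ℝ)..t, v τ :=
  intervalIntegral.integral_nonneg ht fun s _ => h.v_nonneg s

include hb hm hα hbμ hmμ

/-- Here y' ≥ κy in integrated form and y(0) ≥ bM(0) > 0. Continuous induction keeps y positive,
hence y ≥ bM(0), and integrating once more gives linear growth, which is all that is needed later.
-/
theorem excess_growth (h : EnergyDynamics b m α e M r v T) (hM0 : 0 < M 0)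
    (he : α * (μ + 1) / (m * (α - 2)) * e ≤ r 0) :
    ∀ t ∈ Ico 0 T, b * M 0 * (1 + m * (α - 2) / (μ + 1) * t)
      ≤ 2 * r t + b * M t - 2 * (α * (μ + 1) / (m * (α - 2)) * e) := by
  set κ := m * (α - 2) / (μ + 1) with hκ
  set y : ℝ → ℝ := fun t => 2 * r t + b * M t - 2 * (α * (μ + 1) / (m * (α - 2)) * e) with hy
  have hμ : 0 < μ + 1 := by linarith
  have hα' : 0 < α - 2 := by linarith
  have hκ0 : 0 < κ := by positivity
  have hκα : κ ≤ α + 2 := by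
    rw [hκ, div_le_iff₀ hμ]
    nlinarith
  have hyc : ContinuousOn y (Ico 0 T) := ((continuousOn_const.mul h.continuousOn_r).add
    (continuousOn_const.mul h.continuousOn_M)).sub continuousOn_const
  have hgrow : ∀ t ∈ Ico 0 T, κ * ∫ s in (0 : ℝ)..t, y s ≤ y t - y 0 := by
    intro t ht
    have hsub : Icc 0 t ⊆ Ico 0 T := Icc_subset_Ico_right ht.2
    have e1 : y t - y 0 = 2 * r t + b * M t - (2 * r 0 + b * M 0) := by
      simp only [hy]; ring
    rw [e1, ← intervalIntegral.integral_const_mul]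
    refine le_trans ?_ (h.increment 0 t le_rfl ht.1 ht.2)
    refine intervalIntegral.integral_mono_on ht.1
      ((continuousOn_const.mul (hyc.mono hsub)).intervalIntegrable_of_Icc ht.1)
      ((h.continuousOn_integrand.mono hsub).intervalIntegrable_of_Icc ht.1) fun s hs => ?_
    have h1 := h.integrand_ge hb hm hα hbμ s
    have h2 := mul_nonneg (sub_nonneg.2 hκα) (h.v_nonneg s)
    have h3 := mul_nonneg (by positivity : 0 ≤ 2 * α * b) (h.integral_v_nonneg hs.1)
    simp only [hy]
    linarith
  have hy0 : b * M 0 ≤ y 0 := by simp only [hy]; linarith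
  have hbM : 0 < b * M 0 := mul_pos hb hM0
  have hpos : ∀ t ∈ Ico 0 T, 0 < y t := by
    refine pos_of_pos_on_initial_segment hyc fun t ht hp => ?_
    have : 0 ≤ ∫ s in (0 : ℝ)..t, y s := by
      refine intervalIntegral.integral_nonneg_of_ae_restrict ht.1 ?_
      rw [EventuallyLE, ← restrict_Ico_eq_restrict_Icc, ae_restrict_iff' measurableSet_Ico]
      exact Eventually.of_forall fun s hs => (hp s hs).le
    have := mul_nonneg hκ0.le this
    have := hgrow t ht
    linarith
  have hmin : ∀ t ∈ Ico 0 T, b * M 0 ≤ y t := by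
    intro t ht
    have : 0 ≤ ∫ s in (0 : ℝ)..t, y s := intervalIntegral.integral_nonneg ht.1 fun s hs =>
      (hpos s ⟨hs.1, hs.2.trans_lt ht.2⟩).le
    have := mul_nonneg hκ0.le this
    have := hgrow t ht
    linarith
  intro t ht
  have hsub : Icc 0 t ⊆ Ico 0 T := Icc_subset_Ico_right ht.2
  have h1 : ∫ _ in (0 : ℝ)..t, b * M 0 ≤ ∫ s in (0 : ℝ)..t, y s :=
    intervalIntegral.integral_mono_on ht.1 (by simp)
      ((hyc.mono hsub).intervalIntegrable_of_Icc ht.1)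
      fun s hs => hmin s (hsub hs)
  rw [intervalIntegral.integral_const, sub_zero, smul_eq_mul] at h1
  have h2 := hgrow t ht
  have h3 := mul_le_mul_of_nonneg_left h1 hκ0.le
  change _ ≤ y t
  nlinarith

/-- The concavity method started at t₀. The free start t₀ lets one wait until P' is large, and T₀
only has to bound the lifespan from above. -/
theorem lifespan_sub_le (h : EnergyDynamics b m α e M r v T) (hM0 : 0 < M 0)
    (he : α * (μ + 1) / (m * (α - 2)) * e ≤ r 0) {t₀ T₀ : ℝ} (ht₀ : t₀ ∈ Ico 0 T) (hT₀ : T ≤ T₀)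
    (hp : 0 < 2 * r t₀ + b * M t₀ - b * M 0) :
    T - t₀ ≤ (M t₀ + b * (∫ s in (0 : ℝ)..t₀, M s) + b * (T₀ - t₀) * M 0)
      / ((α - 2) * (μ + 1 - m) / (4 * (μ + 1)) * (2 * r t₀ + b * M t₀ - b * M 0)) := by
  set γ := (α - 2) * (μ + 1 - m) / (4 * (μ + 1)) with hγ
  have hμ : 0 < μ + 1 := by linarith
  have hα' : 0 < α - 2 := by linarith
  have hγ0 : 0 < γ := by
    have : 0 < μ + 1 - m := by linarith
    positivity
  set κ := m * (α - 2) / (μ + 1) with hκ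
  have hκ0 : 0 < κ := by positivity
  -- The coefficient α + 2 − κ of v, left after the excess has taken its share κ, must equal the
  -- Cauchy–Schwarz factor 4 times 1 + γ.
  have hγκ : 4 * (1 + γ) = α + 2 - κ := by
    rw [hγ, hκ]
    field_simp
    ring
  -- The last term removes bM(t) − bM(0) = 2b∫r from being off by a constant: P' becomes exactly 2(r
  -- + b∫r). It also keeps P positive up to T₀.
  set P : ℝ → ℝ := fun t => M t + b * (∫ s in (0 : ℝ)..t, M s) + b * (T₀ - t) * M 0 with hP
  set p : ℝ → ℝ := fun t => 2 * r t + b * M t - b * M 0 with hpd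
  have hPc : ContinuousOn P (Ico 0 T) := (h.continuousOn_M.add
    (continuousOn_const.mul (continuousOn_primitive h.continuousOn_M))).add (by fun_prop)
  have hpc : ContinuousOn p (Ico 0 T) := ((continuousOn_const.mul h.continuousOn_r).add
    (continuousOn_const.mul h.continuousOn_M)).sub continuousOn_const
  have hPder : ∀ t ∈ Ioo 0 T, HasDerivAt P (p t) t := by
    intro t ht
    have h1 := (h.hasDerivAt_M t ht).add ((hasDerivAt_primitive h.continuousOn_M ht).const_mul b)
    have h2 : HasDerivAt (fun t => b * (T₀ - t) * M 0) (b * (-1) * M 0) t :=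
      (((hasDerivAt_id t).const_sub T₀).const_mul b).mul_const (M 0)
    refine (h1.add h2).congr_deriv ?_
    simp only [hpd]
    ring
  have hMi : ∀ t, 0 ≤ t → 0 ≤ ∫ s in (0 : ℝ)..t, M s := fun t ht =>
    intervalIntegral.integral_nonneg ht fun s _ => h.M_nonneg s
  have hPpos : ∀ t ∈ Ico 0 T, 0 < P t := by
    intro t ht
    have h1 := h.M_nonneg t
    have h2 := mul_nonneg hb.le (hMi t ht.1)
    have h3 : 0 < b * (T₀ - t) * M 0 := mul_pos (mul_pos hb (by linarith [ht.2])) hM0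
    simp only [hP]
    linarith
  have hpint : ∀ t ∈ Ico 0 T, p t = 2 * (r t + b * ∫ s in (0 : ℝ)..t, r s) := by
    intro t ht
    have hsub : Icc 0 t ⊆ Ico 0 T := Icc_subset_Ico_right ht.2
    have := intervalIntegral.integral_eq_sub_of_hasDerivAt_of_le ht.1 (h.continuousOn_M.mono hsub)
      (fun s hs => h.hasDerivAt_M s ⟨hs.1, hs.2.trans ht.2⟩)
      ((continuousOn_const.mul (h.continuousOn_r.mono hsub)).intervalIntegrable_of_Icc ht.1)
    rw [intervalIntegral.integral_const_mul] at this
    simp only [hpd]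
    linear_combination (-b) * this
  have hcs : ∀ t ∈ Ico 0 T, p t ^ 2 / P t ≤ 4 * (v t + b * ∫ s in (0 : ℝ)..t, v s) := by
    intro t ht
    have hsub : Icc 0 t ⊆ Ico 0 T := Icc_subset_Ico_right ht.2
    have iM := (h.continuousOn_M.mono hsub).intervalIntegrable_of_Icc (μ := volume) ht.1
    have ir := (h.continuousOn_r.mono hsub).intervalIntegrable_of_Icc (μ := volume) ht.1
    have iv := (h.continuousOn_v.mono hsub).intervalIntegrable_of_Icc (μ := volume) ht.1
    -- Cauchy–Schwarz for the pair formed by the present value and the weighted history: the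
    -- quadratic forms add and integrate in time, and the discriminant is taken at the end.
    have hq : ∀ x : ℝ, 0 ≤ (M t + b * ∫ s in (0 : ℝ)..t, M s) * (x * x)
        + 2 * (r t + b * ∫ s in (0 : ℝ)..t, r s) * x + (v t + b * ∫ s in (0 : ℝ)..t, v s) := by
      intro x
      have h1 : 0 ≤ ∫ s in (0 : ℝ)..t, (M s * (x * x) + 2 * r s * x + v s) :=
        intervalIntegral.integral_nonneg ht.1 fun s _ => h.quadratic_nonneg s x
      rw [intervalIntegral.integral_add ((iM.mul_const _).add ((ir.const_mul 2).mul_const x)) iv,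
        intervalIntegral.integral_add (iM.mul_const _) ((ir.const_mul 2).mul_const x),
        intervalIntegral.integral_mul_const, intervalIntegral.integral_mul_const,
        intervalIntegral.integral_const_mul] at h1
      have h2 := h.quadratic_nonneg t x
      have h3 := mul_nonneg hb.le h1
      nlinarith
    have hdisc := discrim_le_zero hq
    rw [discrim, ← hpint t ht] at hdisc
    rw [div_le_iff₀ (hPpos t ht)]
    have hV : 0 ≤ v t + b * ∫ s in (0 : ℝ)..t, v s :=
      add_nonneg (h.v_nonneg t) (mul_nonneg hb.le (h.integral_v_nonneg ht.1))
    have hPle : M t + b * ∫ s in (0 : ℝ)..t, M s ≤ P t := by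
      have : 0 ≤ b * (T₀ - t) * M 0 := mul_nonneg (mul_nonneg hb.le (by linarith [ht.2])) hM0.le
      simp only [hP]
      linarith
    nlinarith [mul_le_mul_of_nonneg_right hPle hV]
  have hexc := h.excess_growth hb hm hα hbμ hmμ hM0 he
  have hinc : ∀ t ∈ Ico t₀ T, (∫ s in t₀..t, (1 + γ) * (p s ^ 2 / P s)) ≤ p t - p t₀ := by
    intro t ht
    have hsub : Icc t₀ t ⊆ Ico 0 T := fun s hs => ⟨ht₀.1.trans hs.1, hs.2.trans_lt ht.2⟩
    have e1 : p t - p t₀ = 2 * r t + b * M t - (2 * r t₀ + b * M t₀) := by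
      simp only [hpd]; ring
    rw [e1]
    refine le_trans ?_ (h.increment t₀ t ht₀.1 ht.1 ht.2)
    refine intervalIntegral.integral_mono_on ht.1
      ((continuousOn_const.mul ((hpc.pow 2).div hPc fun s hs =>
        (hPpos s hs).ne')).mono hsub |>.intervalIntegrable_of_Icc ht.1)
      ((h.continuousOn_integrand.mono hsub).intervalIntegrable_of_Icc ht.1) fun s hs => ?_
    have hs' := hsub hs
    have h1 := h.integrand_ge hb hm hα hbμ s
    have h2 := hexc s hs'
    have h3 : 0 ≤ b * M 0 * (1 + κ * s) :=
      mul_nonneg (mul_nonneg hb.le hM0.le) (by nlinarith [hs'.1])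
    have h4 := mul_nonneg hκ0.le (h3.trans h2)
    have h5 : 0 ≤ b * ∫ τ in (0 : ℝ)..s, v τ := mul_nonneg hb.le (h.integral_v_nonneg hs'.1)
    have h6 := mul_le_mul_of_nonneg_left (hcs s hs') (by linarith : 0 ≤ 1 + γ)
    -- The damping integral comes with coefficient 2α, and only α + 2 − κ of it is needed.
    have h7 : 0 ≤ (α - 2 + κ) * (b * ∫ τ in (0 : ℝ)..s, v τ) := mul_nonneg (by linarith) h5
    have e2 : (1 + γ) * (4 * (v s + b * ∫ τ in (0 : ℝ)..s, v τ))
        = (α + 2 - κ) * (v s + b * ∫ τ in (0 : ℝ)..s, v τ) := by rw [← hγκ]; ring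
    nlinarith
  have hshift : ∀ s, t₀ + s ∈ Ico 0 T → 0 ≤ s → (∫ x in (0 : ℝ)..s,
      (1 + γ) * (p (t₀ + x) ^ 2 / P (t₀ + x))) ≤ p (t₀ + s) - p (t₀ + 0) := by
    intro s hs hs0
    have := hinc (t₀ + s) ⟨by linarith, hs.2⟩
    rw [intervalIntegral.integral_comp_add_left (fun x => (1 + γ) * (p x ^ 2 / P x)), add_zero]
    exact this
  have hmaps : MapsTo (fun s => t₀ + s) (Ico 0 (T - t₀)) (Ico 0 T) := fun s hs =>
    ⟨add_nonneg ht₀.1 hs.1, by linarith [hs.2]⟩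
  have := le_of_concavity (P := fun s => P (t₀ + s)) (p := fun s => p (t₀ + s)) (T := T - t₀)
    (sub_pos.2 ht₀.2) hγ0
    (hPc.comp (continuous_const.add continuous_id).continuousOn hmaps)
    (fun s hs => (hPder (t₀ + s) ⟨by linarith [ht₀.1, hs.1], by linarith [hs.2]⟩).comp_const_add
      t₀ s)
    (hpc.comp (continuous_const.add continuous_id).continuousOn hmaps)
    (fun s hs => hPpos _ (hmaps hs)) (by simpa only [add_zero] using hp)
    (fun s hs => hshift s (hmaps hs) hs.1)
  simpa only [add_zero] using this

theorem lifespan_le (h : EnergyDynamics b m α e M r v T) (hT : 0 < T) (hM0 : 0 < M 0)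
    (he : α * (μ + 1) / (m * (α - 2)) * e ≤ r 0) (hr : 0 < r 0) {T₀ : ℝ} (hT₀ : T ≤ T₀) :
    T ≤ 2 * (μ + 1) * (b * T₀ + 1) / ((α - 2) * (μ + 1 - m)) * (M 0 / r 0) := by
  have := h.lifespan_sub_le hb hm hα hbμ hmμ hM0 he ⟨le_rfl, hT⟩ hT₀ (by linarith)
  have hμ : 0 < μ + 1 := by linarith
  have hα' : 0 < α - 2 := by linarith
  have hmm : 0 < μ + 1 - m := by linarith
  rw [sub_zero, sub_zero, intervalIntegral.integral_same] at this
  refine this.trans_eq ?_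
  have e1 : 2 * r 0 + b * M 0 - b * M 0 = 2 * r 0 := by ring
  rw [e1]
  field_simp
  ring

/-- With T₀ equal to the lifespan t₀ + L, the bound reads L·γp ≤ C + L·bM(0). It is contradictory
for large L once γp > bM(0), which the linear growth of the excess guarantees at a late time t₀. -/
theorem not_global (h : ∀ T, 0 < T → EnergyDynamics b m α e M r v T) (hM0 : 0 < M 0)
    (he : α * (μ + 1) / (m * (α - 2)) * e ≤ r 0) : False := by
  set γ := (α - 2) * (μ + 1 - m) / (4 * (μ + 1)) with hγ
  have hμ : 0 < μ + 1 := by linarith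
  have hα' : 0 < α - 2 := by linarith
  have hγ0 : 0 < γ := by
    have : 0 < μ + 1 - m := by linarith
    positivity
  set κ := m * (α - 2) / (μ + 1) with hκ
  have hκ0 : 0 < κ := by positivity
  set d := 2 * (α * (μ + 1) / (m * (α - 2)) * e) with hd
  have hbM : 0 < b * M 0 := mul_pos hb hM0
  obtain ⟨t₀, ht₀, hbig⟩ : ∃ t₀ : ℝ, 0 ≤ t₀ ∧
      b * M 0 / γ + b * M 0 - d < b * M 0 * (1 + κ * t₀) := by
    obtain ⟨x, hx⟩ := exists_gt (max 0 ((b * M 0 / γ + b * M 0 - d) / (b * M 0 * κ)))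
    refine ⟨x, (le_max_left _ _).trans hx.le, ?_⟩
    have := (le_max_right _ _).trans_lt hx
    rw [div_lt_iff₀ (by positivity)] at this
    nlinarith
  set p := 2 * r t₀ + b * M t₀ - b * M 0 with hp
  have hpbig : b * M 0 / γ < p := by
    have := (h (t₀ + 1) (by linarith)).excess_growth hb hm hα hbμ hmμ hM0 he t₀
      ⟨ht₀, by linarith⟩
    linarith
  have hp0 : 0 < p := (div_pos hbM hγ0).trans hpbig
  have hgap : b * M 0 < γ * p := by rwa [div_lt_iff₀' hγ0] at hpbig
  set C := M t₀ + b * ∫ s in (0 : ℝ)..t₀, M s with hC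
  obtain ⟨L, hL⟩ := exists_gt (max 0 (C / (γ * p - b * M 0)))
  have hL0 : 0 < L := (le_max_left _ _).trans_lt hL
  have hLC : C < L * (γ * p - b * M 0) := by
    have := (le_max_right _ _).trans_lt hL
    rwa [div_lt_iff₀ (by linarith)] at this
  have := (h (t₀ + L) (by linarith)).lifespan_sub_le hb hm hα hbμ hmμ hM0 he (t₀ := t₀)
    ⟨ht₀, by linarith⟩ le_rfl hp0
  rw [add_sub_cancel_left, le_div_iff₀ (by positivity)] at this
  nlinarith

end EnergyDynamics

end ScalarDynamics

/-! ### Conjugation in complex L² -/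

section ComplexL2

variable {Ω : Type*} [MeasurableSpace Ω] {ν : Measure Ω}

theorem star_add_Lp (u v : Lp ℂ 2 ν) : star (u + v) = star u + star v := by
  refine Lp.ext ?_
  filter_upwards [Lp.coeFn_star (u + v), Lp.coeFn_add u v, Lp.coeFn_add (star u) (star v),
    Lp.coeFn_star u, Lp.coeFn_star v] with p h1 h2 h3 h4 h5
  rw [h1, h3, Pi.star_apply, h2, Pi.add_apply, Pi.add_apply, h4, h5, Pi.star_apply, Pi.star_apply]
  exact map_add (starRingEnd ℂ) _ _

theorem norm_star_Lp (u : Lp ℂ 2 ν) : ‖star u‖ = ‖u‖ := by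
  have h : ∀ᵐ p ∂ν, ‖(star u : Lp ℂ 2 ν) p‖ = ‖u p‖ := by
    filter_upwards [Lp.coeFn_star u] with p hp
    rw [hp, Pi.star_apply, norm_star]
  exact le_antisymm (Lp.norm_le_norm_of_ae_le (h.mono fun p hp => hp.le))
    (Lp.norm_le_norm_of_ae_le (h.mono fun p hp => hp.ge))

theorem inner_star_left (u v : Lp ℂ 2 ν) : inner ℂ (star u) v = ∫ p, u p * v p ∂ν := by
  rw [L2.inner_def]
  refine integral_congr_ae ?_
  filter_upwards [Lp.coeFn_star u] with p hp
  rw [hp, RCLike.inner_apply, Pi.star_apply, starRingEnd_apply, star_star, mul_comm]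

theorem inner_star_star (u v : Lp ℂ 2 ν) : inner ℂ (star u) (star v) = inner ℂ v u := by
  rw [L2.inner_def, L2.inner_def]
  refine integral_congr_ae ?_
  filter_upwards [Lp.coeFn_star u, Lp.coeFn_star v] with p hp hq
  rw [hp, hq, RCLike.inner_apply, RCLike.inner_apply, Pi.star_apply, Pi.star_apply,
    starRingEnd_apply, star_star, mul_comm, starRingEnd_apply]

end ComplexL2

variable {n : ℕ}

theorem bilinPair_eq_inner (u v : HeisL2 n) : bilinPair u v = inner ℂ (star u) v :=
  (inner_star_left u v).symm

theorem bilinPair_star_right (u v : HeisL2 n) : bilinPair u (star v) = inner ℂ v u := by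
  rw [bilinPair_eq_inner, inner_star_star]

theorem re_inner_comm {E : Type*} [SeminormedAddCommGroup E] [InnerProductSpace ℂ E] (x y : E) :
    (inner ℂ x y).re = (inner ℂ y x).re := inner_re_symm (𝕜 := ℂ) x y

/-! ### Weak horizontal derivatives and test functions -/

section TestFunctions

theorem memLp_ofReal_comp {ψ : Heis n → ℝ} (hψ : Continuous ψ) (hc : HasCompactSupport ψ) :
    MemLp (fun p => ((ψ p : ℝ) : ℂ)) 2 (volume : Measure (Heis n)) := by
  refine (Complex.continuous_ofReal.comp hψ).memLp_of_hasCompactSupport ?_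
  exact hc.comp_left (g := fun x : ℝ => (x : ℂ)) Complex.ofReal_zero

theorem integral_smul_eq_inner {ψ : Heis n → ℝ} (hψ : Continuous ψ) (hc : HasCompactSupport ψ)
    (v : HeisL2 n) :
    ∫ p, ψ p • v p = inner ℂ ((memLp_ofReal_comp hψ hc).toLp _) v := by
  rw [L2.inner_def]
  refine integral_congr_ae ?_
  filter_upwards [(memLp_ofReal_comp hψ hc).coeFn_toLp] with p hp
  rw [hp, RCLike.inner_apply, Complex.conj_ofReal, Complex.real_smul, mul_comm]

theorem IsWeakHorizontalDeriv.star {j : Fin n ⊕ Fin n} {u w : HeisL2 n}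
    (h : IsWeakHorizontalDeriv j u w) : IsWeakHorizontalDeriv j (star u) (star w) := by
  have key : ∀ (ψ : Heis n → ℝ) (v : HeisL2 n),
      ∫ p, ψ p • (Star.star v : HeisL2 n) p = conj (∫ p, ψ p • v p) := by
    intro ψ v
    rw [← integral_conj]
    refine integral_congr_ae ?_
    filter_upwards [Lp.coeFn_star v] with p hp
    rw [hp, Pi.star_apply, Complex.real_smul, Complex.real_smul, map_mul, Complex.conj_ofReal,
      starRingEnd_apply]
  intro φ hφ hc
  rw [key, key, h φ hφ hc, map_neg]

theorem IsWeakHorizontalDeriv.eq_zero {j : Fin n ⊕ Fin n} {w : HeisL2 n}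
    (h : IsWeakHorizontalDeriv j 0 w) : w = 0 := by
  refine (Lp.eq_zero_iff_ae_eq_zero).2 ?_
  refine ae_eq_zero_of_integral_contDiff_smul_eq_zero
    ((Lp.memLp w).locallyIntegrable (by norm_num)) fun φ hφ hc => ?_
  have := h φ hφ hc
  rw [integral_smul_eq_inner (continuous_horizontalDeriv j hφ)
    (hasCompactSupport_horizontalDeriv j hc), inner_zero_right] at this
  exact neg_eq_zero.1 this.symm

end TestFunctions

/-! ### The Hilbert space H¹ -/

namespace HeisH1

/-- Integrals against a fixed test function are inner products with a fixed L² vector, so each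
defining condition is closed. Completeness of H¹ follows, as needed for integrals with values in it.
-/
theorem isClosed_sobolevGraph (n : ℕ) : IsClosed (sobolevGraph n :
    Set (WithLp 2 (HeisL2 n × PiLp 2 (fun _ : Fin n ⊕ Fin n => HeisL2 n)))) := by
  have e : (sobolevGraph n : Set (WithLp 2 (HeisL2 n × PiLp 2 (fun _ : Fin n ⊕ Fin n => HeisL2 n))))
      = ⋂ (j : Fin n ⊕ Fin n) (φ : Heis n → ℝ) (hφ : ContDiff ℝ ∞ φ) (hc : HasCompactSupport φ),
        {q | inner ℂ ((memLp_ofReal_comp (continuous_horizontalDeriv j hφ)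
            (hasCompactSupport_horizontalDeriv j hc)).toLp _) q.fst
          = - inner ℂ ((memLp_ofReal_comp hφ.continuous hc).toLp _) (q.snd j)} := by
    ext q
    simp only [mem_iInter]
    refine forall_congr' fun j => forall_congr' fun φ => forall_congr' fun hφ =>
      forall_congr' fun hc => ?_
    rw [mem_ofPred_eq, ← integral_smul_eq_inner (continuous_horizontalDeriv j hφ)
      (hasCompactSupport_horizontalDeriv j hc), ← integral_smul_eq_inner hφ.continuous hc]
  rw [e]
  refine isClosed_iInter fun j => isClosed_iInter fun φ => isClosed_iInter fun hφ =>
    isClosed_iInter fun hc => isClosed_eq ?_ ?_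
  · exact continuous_const.inner (WithLp.prod_continuous_ofLp _ _ _).fst
  · refine (continuous_const.inner ?_).neg
    exact (PiLp.continuous_apply 2 _ j).comp (WithLp.prod_continuous_ofLp _ _ _).snd

instance : CompleteSpace (HeisH1 n) := (isClosed_sobolevGraph n).completeSpace_coe

theorem norm_sq_eq (u : HeisH1 n) : ‖u‖ ^ 2 = ‖u.toL2‖ ^ 2 + ∑ j, ‖u.grad j‖ ^ 2 := by
  rw [Submodule.coe_norm, WithLp.prod_norm_sq_eq_of_L2, PiLp.norm_sq_eq_of_L2]
  rfl

theorem inner_eq (u v : HeisH1 n) :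
    inner ℂ u v = inner ℂ u.toL2 v.toL2 + ∑ j, inner ℂ (u.grad j) (v.grad j) := by
  rw [Submodule.coe_inner, WithLp.prod_inner_apply, PiLp.inner_apply]
  rfl

theorem norm_toL2_le (u : HeisH1 n) : ‖u.toL2‖ ≤ ‖u‖ := by
  refine le_of_sq_le_sq ?_ (norm_nonneg _)
  rw [norm_sq_eq]
  exact le_add_of_nonneg_right (Finset.sum_nonneg fun _ _ => sq_nonneg _)

/-- The embedding of `H¹` into `L²`. -/
noncomputable def toL2CLM (n : ℕ) : HeisH1 n →L[ℂ] HeisL2 n :=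
  LinearMap.mkContinuous
    { toFun := fun u => u.toL2, map_add' := fun _ _ => rfl, map_smul' := fun _ _ => rfl } 1
    fun u => (norm_toL2_le u).trans_eq (one_mul _).symm

theorem toL2_sub (u v : HeisH1 n) : (u - v).toL2 = u.toL2 - v.toL2 := rfl

/-- The weak gradient of 0 pairs to 0 with every test function. The resulting injectivity of H¹ → L²
lifts identities from L² to H¹. -/
theorem eq_zero_of_toL2_eq_zero {u : HeisH1 n} (h : u.toL2 = 0) : u = 0 := by
  have hg : ∀ j, u.grad j = 0 := fun j => by
    have := u.2 j
    change IsWeakHorizontalDeriv j u.toL2 (u.grad j) at this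
    rw [h] at this
    exact this.eq_zero
  have : ‖u‖ ^ 2 = 0 := by
    rw [norm_sq_eq, h]
    simp [hg]
  exact norm_eq_zero.1 (pow_eq_zero_iff two_ne_zero |>.1 this)

theorem toL2_injective : Function.Injective (HeisH1.toL2 (n := n)) := fun u v h =>
  sub_eq_zero.1 (eq_zero_of_toL2_eq_zero (by rw [toL2_sub, h, sub_self]))

/-- Complex conjugation on `H¹`. -/
noncomputable def conjugate (u : HeisH1 n) : HeisH1 n :=
  ⟨WithLp.toLp 2 (star u.toL2, WithLp.toLp 2 fun j => star (u.grad j)), fun j => (u.2 j).star⟩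

theorem toL2_conjugate (u : HeisH1 n) : u.conjugate.toL2 = star u.toL2 := rfl

theorem grad_conjugate (u : HeisH1 n) (j : Fin n ⊕ Fin n) :
    u.conjugate.grad j = star (u.grad j) := rfl

theorem norm_conjugate (u : HeisH1 n) : ‖u.conjugate‖ = ‖u‖ := by
  have : ‖u.conjugate‖ ^ 2 = ‖u‖ ^ 2 := by
    simp only [norm_sq_eq, toL2_conjugate, grad_conjugate, norm_star_Lp]
  exact (sq_eq_sq₀ (norm_nonneg _) (norm_nonneg _)).1 this

theorem conjugate_add (u v : HeisH1 n) : (u + v).conjugate = u.conjugate + v.conjugate :=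
  toL2_injective (star_add_Lp u.toL2 v.toL2)

theorem continuous_conjugate : Continuous (conjugate (n := n)) := by
  let f : HeisH1 n →+ HeisH1 n := AddMonoidHom.mk' conjugate conjugate_add
  exact (AddMonoidHomClass.isometry_of_norm f norm_conjugate).continuous

theorem memLp_conjugate {U : ℝ → HeisH1 n} {μ : Measure ℝ} (hU : MemLp U 2 μ) :
    MemLp (fun t => (U t).conjugate) 2 μ :=
  hU.of_le (continuous_conjugate.comp_aestronglyMeasurable hU.1)
    (Eventually.of_forall fun t => (norm_conjugate (U t)).le)

end HeisH1

/-! ### Energy identities for abstract curves -/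

section Pairings

/-- The real part of the inner product, as a bounded real bilinear map. -/
noncomputable def reInner (E : Type*) [NormedAddCommGroup E] [InnerProductSpace ℂ E] :
    E →L[ℝ] E →L[ℝ] ℝ :=
  LinearMap.mkContinuous₂ (LinearMap.mk₂ ℝ (fun x y : E => (inner ℂ x y).re)
    (fun x y z => by rw [inner_add_left, Complex.add_re])
    (fun c x y => by
      rw [RCLike.real_smul_eq_coe_smul (K := ℂ) c x, inner_smul_left]
      simp)
    (fun x y z => by rw [inner_add_right, Complex.add_re])
    (fun c x y => by
      rw [RCLike.real_smul_eq_coe_smul (K := ℂ) c y, inner_smul_right]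
      simp)) 1 fun x y => by
    rw [one_mul]
    exact (Complex.abs_re_le_norm _).trans (norm_inner_le_norm x y)

theorem reInner_apply {E : Type*} [NormedAddCommGroup E] [InnerProductSpace ℂ E] (x y : E) :
    reInner E x y = (inner ℂ x y).re := rfl

/-- The real part of the evaluation of a dual space, as a bounded real bilinear map. -/
noncomputable def reEval (V : Type*) [NormedAddCommGroup V] [NormedSpace ℂ V] :
    StrongDual ℂ V →L[ℝ] V →L[ℝ] ℝ :=
  LinearMap.mkContinuous₂ (LinearMap.mk₂ ℝ (fun (W : StrongDual ℂ V) v => (W v).re)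
    (fun x y z => by simp)
    (fun c x y => by simp)
    (fun x y z => by simp)
    (fun c x y => by
      rw [RCLike.real_smul_eq_coe_smul (K := ℂ) c y, map_smul]
      simp)) 1 fun x y => by
    rw [one_mul]
    exact (Complex.abs_re_le_norm _).trans (x.le_opNorm y)

theorem reEval_apply {V : Type*} [NormedAddCommGroup V] [NormedSpace ℂ V] (W : StrongDual ℂ V)
    (v : V) : reEval V W v = (W v).re := rfl

theorem intervalIntegrable_of_memLp_two {E : Type*} [NormedAddCommGroup E] {y : ℝ → E} {S s t : ℝ}
    (hy : MemLp y 2 (volume.restrict (Icc 0 S))) (hs : s ∈ Icc 0 S) (ht : t ∈ Icc 0 S) :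
    IntervalIntegrable y volume s t := by
  have h1 : IntegrableOn y (Icc 0 S) := hy.integrable (by norm_num)
  rw [intervalIntegrable_iff]
  exact h1.mono_set (uIoc_subset_uIcc.trans (uIcc_subset_Icc hs ht))

theorem memLp_two_of_continuousOn {E : Type*} [NormedAddCommGroup E]
    {y : ℝ → E} {S : ℝ} (hy : ContinuousOn y (Icc 0 S)) :
    MemLp y 2 (volume.restrict (Icc 0 S)) := by
  obtain ⟨C, hC⟩ := isCompact_Icc.exists_bound_of_continuousOn hy
  refine MemLp.of_bound (hy.aestronglyMeasurable measurableSet_Icc) C ?_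
  exact (ae_restrict_iff' measurableSet_Icc).2 (Eventually.of_forall hC)

/-- The energy identity for a primitive of a square integrable function. -/
theorem norm_sq_sub_eq_integral {E : Type*} [NormedAddCommGroup E] [InnerProductSpace ℂ E]
    [CompleteSpace E] {x y : ℝ → E} {S T : ℝ} (hT : 0 ≤ T) (hTS : T < S)
    (hx : ContinuousOn x (Icc 0 S)) (hy : MemLp y 2 (volume.restrict (Icc 0 S)))
    (hxy : ∀ s ∈ Icc 0 S, ∀ s' ∈ Icc 0 S, x s - x s' = ∫ r in s'..s, y r) :
    IntervalIntegrable (fun s => (inner ℂ (y s) (x s)).re) volume 0 T ∧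
    ‖x T‖ ^ 2 - ‖x 0‖ ^ 2 = 2 * ∫ s in (0 : ℝ)..T, (inner ℂ (y s) (x s)).re := by
  have hx2 := memLp_two_of_continuousOn hx
  have hsq : ∀ z : E, (inner ℂ z z).re = ‖z‖ ^ 2 := fun z => inner_self_eq_norm_sq (𝕜 := ℂ) z
  have hinc : ∀ z : E, ∀ s ∈ Icc 0 S, ∀ s' ∈ Icc 0 S, (inner ℂ (x s) z).re - (inner ℂ (x s') z).re
      = ∫ r in s'..s, reInner E (y r) z := by
    intro z s hs s' hs'
    rw [← Complex.sub_re, ← inner_sub_left, hxy s hs s' hs']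
    have := ((reInner E).flip z).intervalIntegral_comp_comm
      (intervalIntegrable_of_memLp_two hy hs' hs)
    exact this.symm
  have hi := intervalIntegrable_pairing (reInner E) hy hx2 hT hTS.le
  refine ⟨hi, ?_⟩
  have := diagonal_sub_eq_integral (c := fun s t => (inner ℂ (x s) (x t)).re) hT hTS (reInner E)
    (reInner E) hy hx2 hy hx2 ?_ (Eventually.of_forall fun t s hs s' hs' => hinc (x t) s hs s' hs')
    (Eventually.of_forall fun s t ht t' ht' => ?_)
  · simp only [hsq] at this
    rw [this, ← intervalIntegral.integral_const_mul]
    refine intervalIntegral.integral_congr fun s _ => ?_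
    simp only [reInner_apply]
    ring
  · simp only [hsq]
    exact hx.norm.pow 2
  · rw [re_inner_comm (x s), re_inner_comm (x s)]
    exact hinc (x s) t ht t' ht'

variable {V H : Type*} [NormedAddCommGroup V] [NormedSpace ℂ V] [NormedAddCommGroup H]
  [InnerProductSpace ℂ H]

theorem intervalIntegrable_apply {W : ℝ → StrongDual ℂ V} {S s t : ℝ}
    (hW : MemLp W 2 (volume.restrict (Icc 0 S))) (v : V) (hs : s ∈ Icc 0 S) (ht : t ∈ Icc 0 S) :
    IntervalIntegrable (fun r => W r v) volume s t := by
  have h := intervalIntegrable_of_memLp_two hW hs ht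
  rw [intervalIntegrable_iff] at h ⊢
  exact (ContinuousLinearMap.apply ℂ ℂ v).integrable_comp h

/-- The energy identity for a curve whose derivative is only dual to its values. -/
theorem norm_sq_sub_eq_integral_of_dual {a : ℝ → H} {W : ℝ → StrongDual ℂ V} {B : ℝ → V} {S T : ℝ}
    (hT : 0 ≤ T) (hTS : T < S) (ha : ContinuousOn a (Icc 0 S))
    (hW : MemLp W 2 (volume.restrict (Icc 0 S))) (hB : MemLp B 2 (volume.restrict (Icc 0 S)))
    (h : ∀ᵐ t ∂(volume.restrict (Icc 0 S)), ∀ s ∈ Icc 0 S, ∀ s' ∈ Icc 0 S,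
      (inner ℂ (a t) (a s)).re - (inner ℂ (a t) (a s')).re = ∫ r in s'..s, (W r (B t)).re) :
    IntervalIntegrable (fun s => (W s (B s)).re) volume 0 T ∧
    ‖a T‖ ^ 2 - ‖a 0‖ ^ 2 = 2 * ∫ s in (0 : ℝ)..T, (W s (B s)).re := by
  have hsq : ∀ z : H, (inner ℂ z z).re = ‖z‖ ^ 2 := fun z => inner_self_eq_norm_sq (𝕜 := ℂ) z
  refine ⟨intervalIntegrable_pairing (reEval V) hW hB hT hTS.le, ?_⟩
  -- Since c is symmetric, both halves of the product rule use the same pair W, B; this produces the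
  -- factor 2.
  have := diagonal_sub_eq_integral (c := fun s t => (inner ℂ (a t) (a s)).re) hT hTS
    (reEval V) (reEval V) hW hB hW hB ?_ h ?_
  · simp only [hsq] at this
    rw [this, ← intervalIntegral.integral_const_mul]
    refine intervalIntegral.integral_congr fun s _ => ?_
    simp only [reEval_apply]
    ring
  · simp only [hsq]
    exact ha.norm.pow 2
  · filter_upwards [h] with s hs t ht t' ht'
    rw [re_inner_comm _ (a s), re_inner_comm _ (a s)]
    exact hs t ht t' ht'

/-- The derivative of `⟨x, a⟩`, where `a` is the derivative of `x` and `W` is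
dual to that of `a`. -/
theorem re_inner_sub_eq_integral_of_dual [CompleteSpace H] {x a : ℝ → H} {W : ℝ → StrongDual ℂ V}
    {B : ℝ → V} {S T : ℝ} (hT : 0 ≤ T) (hTS : T < S)
    (hx : ContinuousOn x (Icc 0 S)) (ha : ContinuousOn a (Icc 0 S))
    (hxa : ∀ s ∈ Icc 0 S, ∀ s' ∈ Icc 0 S, x s - x s' = ∫ r in s'..s, a r)
    (hW : MemLp W 2 (volume.restrict (Icc 0 S))) (hB : MemLp B 2 (volume.restrict (Icc 0 S)))
    (h : ∀ t, ∀ s ∈ Icc 0 S, ∀ s' ∈ Icc 0 S,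
      (inner ℂ (x t) (a s)).re - (inner ℂ (x t) (a s')).re = ∫ r in s'..s, (W r (B t)).re) :
    IntervalIntegrable (fun s => (W s (B s)).re + ‖a s‖ ^ 2) volume 0 T ∧
    (inner ℂ (x T) (a T)).re - (inner ℂ (x 0) (a 0)).re
      = ∫ s in (0 : ℝ)..T, ((W s (B s)).re + ‖a s‖ ^ 2) := by
  have hA := memLp_two_of_continuousOn ha
  have hsq : ∀ z : H, reInner H z z = ‖z‖ ^ 2 := fun z => inner_self_eq_norm_sq (𝕜 := ℂ) z
  have := diagonal_sub_eq_integral (c := fun s t => (inner ℂ (x t) (a s)).re) hT hTS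
    (reEval V) (reInner H) hW hB hA hA ?_ (Eventually.of_forall h)
    (Eventually.of_forall fun s t ht t' ht' => ?_)
  · simp only [hsq, reEval_apply] at this
    refine ⟨?_, this⟩
    have i1 := intervalIntegrable_pairing (reEval V) hW hB hT hTS.le
    have i2 := intervalIntegrable_pairing (reInner H) hA hA hT hTS.le
    simp only [hsq, reEval_apply] at i1 i2
    exact i1.add i2
  · exact Complex.continuous_re.comp_continuousOn (hx.inner ha)
  · rw [← Complex.sub_re, ← inner_sub_left, hxa t ht t' ht']
    exact (((reInner H).flip (a s)).intervalIntegral_comp_comm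
      (intervalIntegrable_of_memLp_two hA ht' ht)).symm

end Pairings

/-! ### Energy identity and growth inequality for weak solutions -/

section WeakSolutions

variable {n : ℕ}

/-- A weak solution on `[0, S]` together with its time derivatives `ut`, `Ut`, `utt` and a bound
`K` of the nonlinear term. -/
structure WeakSolutionData (b m : ℝ) (g : ℝ → ℝ) (u₀ : HeisH1 n) (u₁ : HeisL2 n)
    (u : ℝ → HeisH1 n) (S : ℝ) (ut : ℝ → HeisL2 n) (Ut : ℝ → HeisH1 n) (utt : ℝ → HeisHneg1 n)
    (K : ℝ → ℝ) : Prop where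
  cont : ContinuousOn u (Icc 0 S)
  init : u 0 = u₀
  deriv : ∀ t ∈ Icc 0 S, HasDerivWithinAt (fun s => (u s).toL2) (ut t) (Icc 0 S) t
  cont_ut : ContinuousOn ut (Icc 0 S)
  init_ut : ut 0 = u₁
  memLp_Ut : MemLp Ut 2 (volume.restrict (Icc 0 S))
  Ut_toL2 : ∀ᵐ t ∂(volume.restrict (Icc 0 S)), (Ut t).toL2 = ut t
  memLp_utt : MemLp utt 2 (volume.restrict (Icc 0 S))
  ut_increment : ∀ v : HeisH1 n, ∀ t ∈ Icc 0 S,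
    bilinPair (ut t) v.toL2 - bilinPair u₁ v.toL2 = ∫ s in (0 : ℝ)..t, utt s v
  memLp_K : MemLp K 2 (volume.restrict (Icc 0 S))
  nonlinear_bound : ∀ᵐ t ∂(volume.restrict (Icc 0 S)), ∀ v : HeisH1 n,
    Integrable (fun p => nonlinearity g ((u t).toL2 p) * v.toL2 p) ∧
    ∫ p, ‖nonlinearity g ((u t).toL2 p) * v.toL2 p‖ ≤ K t * ‖v‖
  equation : ∀ᵐ t ∂(volume.restrict (Icc 0 S)), ∀ v : HeisH1 n,
    (utt t v).re + (∑ j, bilinPair ((u t).grad j) (v.grad j)).re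
      + m * (bilinPair (u t).toL2 v.toL2).re + b * (bilinPair (ut t) v.toL2).re
      = (∫ p, nonlinearity g ((u t).toL2 p) * v.toL2 p).re

theorem IsWeakSolutionOn.exists_data {b m : ℝ} {g : ℝ → ℝ} {u₀ : HeisH1 n} {u₁ : HeisL2 n}
    {u : ℝ → HeisH1 n} {S : ℝ} (h : IsWeakSolutionOn b m g u₀ u₁ u S) :
    ∃ ut Ut utt K, WeakSolutionData b m g u₀ u₁ u S ut Ut utt K := by
  obtain ⟨h1, h2, ut, Ut, utt, K, h3, h4, h5, h6, h7, h8, h9, h10, h11, h12⟩ := h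
  exact ⟨ut, Ut, utt, K, h1, h2, h3, h4, h5, h6, h7, h8, h9, h10, h11, h12⟩

theorem integral_mul_conj_congr {g : ℝ → ℝ} (z w w' : HeisL2 n) (h : w = star w') :
    (fun p => nonlinearity g (z p) * w p) =ᵐ[volume]
      fun p => nonlinearity g (z p) * conj (w' p) := by
  subst h
  filter_upwards [Lp.coeFn_star w'] with p hp
  rw [hp, Pi.star_apply, starRingEnd_apply]

namespace WeakSolutionData

variable {b m : ℝ} {g : ℝ → ℝ} {u₀ : HeisH1 n} {u₁ : HeisL2 n} {u : ℝ → HeisH1 n} {S : ℝ}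
  {ut : ℝ → HeisL2 n} {Ut : ℝ → HeisH1 n} {utt : ℝ → HeisHneg1 n} {K : ℝ → ℝ}
  (d : WeakSolutionData b m g u₀ u₁ u S ut Ut utt K)

include d

theorem cont_toL2 : ContinuousOn (fun t => (u t).toL2) (Icc 0 S) :=
  (HeisH1.toL2CLM n).continuous.comp_continuousOn d.cont

theorem hasDerivAt_toL2 {t : ℝ} (ht : t ∈ Ioo 0 S) :
    HasDerivAt (fun s => (u s).toL2) (ut t) t :=
  (d.deriv t (Ioo_subset_Icc_self ht)).hasDerivAt (Icc_mem_nhds ht.1 ht.2)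

theorem intervalIntegrable_ut {s t : ℝ} (hs : s ∈ Icc 0 S) (ht : t ∈ Icc 0 S) :
    IntervalIntegrable ut volume s t :=
  intervalIntegrable_of_memLp_two (memLp_two_of_continuousOn d.cont_ut) hs ht

theorem toL2_sub_eq_integral : ∀ s ∈ Icc 0 S, ∀ s' ∈ Icc 0 S,
    (u s).toL2 - (u s').toL2 = ∫ r in s'..s, ut r := by
  have key : ∀ s ∈ Icc 0 S, ∫ r in (0 : ℝ)..s, ut r = (u s).toL2 - (u 0).toL2 := fun s hs =>
    intervalIntegral.integral_eq_sub_of_hasDerivAt_of_le hs.1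
      (d.cont_toL2.mono (Icc_subset_Icc_right hs.2))
      (fun r hr => d.hasDerivAt_toL2 ⟨hr.1, hr.2.trans_le hs.2⟩)
      (d.intervalIntegrable_ut ⟨le_rfl, hs.1.trans hs.2⟩ hs)
  intro s hs s' hs'
  have h0 : (0 : ℝ) ∈ Icc 0 S := ⟨le_rfl, hs.1.trans hs.2⟩
  rw [← intervalIntegral.integral_interval_sub_left (d.intervalIntegrable_ut h0 hs)
    (d.intervalIntegrable_ut h0 hs'), key s hs, key s' hs']
  abel

/-- The derivative of u is given in L² only. Integration commutes with the injective embedding of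
H¹, so the L² identity lifts. -/
theorem sub_eq_integral : ∀ s ∈ Icc 0 S, ∀ s' ∈ Icc 0 S, u s - u s' = ∫ r in s'..s, Ut r := by
  intro s hs s' hs'
  refine HeisH1.toL2_injective ?_
  have h1 : HeisH1.toL2 (∫ r in s'..s, Ut r) = ∫ r in s'..s, (Ut r).toL2 :=
    ((HeisH1.toL2CLM n).intervalIntegral_comp_comm
      (intervalIntegrable_of_memLp_two d.memLp_Ut hs' hs)).symm
  rw [HeisH1.toL2_sub, d.toL2_sub_eq_integral s hs s' hs', h1]
  refine intervalIntegral.integral_congr_ae ?_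
  have := (ae_restrict_iff' measurableSet_Icc).1 d.Ut_toL2
  filter_upwards [this] with r hr hrs
  exact (hr ((uIoc_subset_uIcc.trans (uIcc_subset_Icc hs' hs)) hrs)).symm

/-- The weak form is bilinear without conjugation, so inner products arise by testing with
conjugates. -/
theorem re_inner_ut_sub (v : HeisH1 n) : ∀ s ∈ Icc 0 S, ∀ s' ∈ Icc 0 S,
    (inner ℂ v.toL2 (ut s)).re - (inner ℂ v.toL2 (ut s')).re
      = ∫ r in s'..s, (utt r v.conjugate).re := by
  intro s hs s' hs'
  have h0 : (0 : ℝ) ∈ Icc 0 S := ⟨le_rfl, hs.1.trans hs.2⟩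
  have hi : ∀ x ∈ Icc 0 S, IntervalIntegrable (fun r => utt r v.conjugate) volume 0 x :=
    fun x hx => intervalIntegrable_apply d.memLp_utt v.conjugate h0 hx
  have e : ∀ x, (inner ℂ v.toL2 (ut x)) = bilinPair (ut x) v.conjugate.toL2 := fun x => by
    rw [HeisH1.toL2_conjugate, bilinPair_star_right]
  have h1 := d.ut_increment v.conjugate s hs
  have h2 := d.ut_increment v.conjugate s' hs'
  have h3 : bilinPair (ut s) v.conjugate.toL2 - bilinPair (ut s') v.conjugate.toL2
      = ∫ r in s'..s, utt r v.conjugate := by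
    rw [← intervalIntegral.integral_interval_sub_left (hi s hs) (hi s' hs'), ← h1, ← h2]
    ring
  rw [e, e, ← Complex.sub_re, h3]
  have hi' : IntervalIntegrable (fun r => utt r v.conjugate) volume s' s :=
    (hi s' hs').symm.trans (hi s hs)
  exact (Complex.reCLM.intervalIntegral_comp_comm hi').symm

theorem norm_sq_ut_sub {t : ℝ} (ht : t ∈ Ico 0 S) :
    IntervalIntegrable (fun s => (utt s (Ut s).conjugate).re) volume 0 t ∧
    ‖ut t‖ ^ 2 - ‖u₁‖ ^ 2 = 2 * ∫ s in (0 : ℝ)..t, (utt s (Ut s).conjugate).re := by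
  rw [← d.init_ut]
  refine norm_sq_sub_eq_integral_of_dual ht.1 ht.2 d.cont_ut d.memLp_utt
    (HeisH1.memLp_conjugate d.memLp_Ut) ?_
  filter_upwards [d.Ut_toL2] with t ht s hs s' hs'
  rw [← ht]
  exact d.re_inner_ut_sub (Ut t) s hs s' hs'

theorem re_inner_sub {t : ℝ} (ht : t ∈ Ico 0 S) :
    IntervalIntegrable (fun s => (utt s (u s).conjugate).re + ‖ut s‖ ^ 2) volume 0 t ∧
    (inner ℂ (u t).toL2 (ut t)).re - (inner ℂ (u 0).toL2 (ut 0)).re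
      = ∫ s in (0 : ℝ)..t, ((utt s (u s).conjugate).re + ‖ut s‖ ^ 2) :=
  re_inner_sub_eq_integral_of_dual ht.1 ht.2 d.cont_toL2 d.cont_ut d.toL2_sub_eq_integral
    d.memLp_utt (HeisH1.memLp_conjugate (memLp_two_of_continuousOn d.cont))
    fun t => d.re_inner_ut_sub (u t)

theorem norm_sq_toL2_sub {t : ℝ} (ht : t ∈ Ico 0 S) :
    IntervalIntegrable (fun s => (inner ℂ (ut s) (u s).toL2).re) volume 0 t ∧
    ‖(u t).toL2‖ ^ 2 - ‖(u 0).toL2‖ ^ 2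
      = 2 * ∫ s in (0 : ℝ)..t, (inner ℂ (ut s) (u s).toL2).re :=
  norm_sq_sub_eq_integral ht.1 ht.2 d.cont_toL2 (memLp_two_of_continuousOn d.cont_ut)
    d.toL2_sub_eq_integral

theorem norm_sq_sub {t : ℝ} (ht : t ∈ Ico 0 S) :
    IntervalIntegrable (fun s => (inner ℂ (Ut s) (u s)).re) volume 0 t ∧
    ‖u t‖ ^ 2 - ‖u 0‖ ^ 2 = 2 * ∫ s in (0 : ℝ)..t, (inner ℂ (Ut s) (u s)).re :=
  norm_sq_sub_eq_integral ht.1 ht.2 d.cont d.memLp_Ut d.sub_eq_integral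

/-- This is the equation tested with the conjugate of u_t. The gradient pairing is the H¹ inner
product minus its L² part, whence m − 1. -/
theorem equation_velocity : ∀ᵐ t ∂(volume.restrict (Icc 0 S)),
    (utt t (Ut t).conjugate).re + (inner ℂ (Ut t) (u t)).re
      + (m - 1) * (inner ℂ (ut t) (u t).toL2).re + b * ‖ut t‖ ^ 2
      = (∫ p, nonlinearity g ((u t).toL2 p) * conj (ut t p)).re := by
  filter_upwards [d.equation, d.Ut_toL2] with t h1 h2
  have h3 := h1 (Ut t).conjugate
  rw [integral_congr_ae (integral_mul_conj_congr (g := g) (u t).toL2 (Ut t).conjugate.toL2 (ut t)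
    (by rw [HeisH1.toL2_conjugate, h2]))] at h3
  simp only [HeisH1.toL2_conjugate, HeisH1.grad_conjugate, bilinPair_star_right, h2] at h3
  have hsq : (inner ℂ (ut t) (ut t)).re = ‖ut t‖ ^ 2 := inner_self_eq_norm_sq (𝕜 := ℂ) (ut t)
  rw [hsq] at h3
  rw [HeisH1.inner_eq, Complex.add_re, h2]
  linarith

theorem equation_self : ∀ᵐ t ∂(volume.restrict (Icc 0 S)),
    (utt t (u t).conjugate).re + ∑ j, ‖(u t).grad j‖ ^ 2
      + m * ‖(u t).toL2‖ ^ 2 + b * (inner ℂ (ut t) (u t).toL2).re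
      = (∫ p, nonlinearity g ((u t).toL2 p) * conj ((u t).toL2 p)).re := by
  filter_upwards [d.equation] with t h1
  have h3 := h1 (u t).conjugate
  rw [integral_congr_ae (integral_mul_conj_congr (g := g) (u t).toL2 (u t).conjugate.toL2 (u t).toL2
    (HeisH1.toL2_conjugate _))] at h3
  simp only [HeisH1.toL2_conjugate, HeisH1.grad_conjugate, bilinPair_star_right] at h3
  have hsq : ∀ z : HeisL2 n, (inner ℂ z z).re = ‖z‖ ^ 2 := fun z => inner_self_eq_norm_sq (𝕜 := ℂ) z
  rw [Complex.re_sum] at h3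
  simp only [hsq] at h3
  rw [re_inner_comm (ut t)]
  exact h3

/-- The bound on f(u), applied to the conjugate of u_t, gives the majorant K‖u_t‖ with the H¹ norm
of u_t. It is integrable in time as a product of two L² functions. -/
theorem potential_integral (hg : ContDiffOn ℝ 1 g (Ici 0)) {t : ℝ} (ht : t ∈ Ico 0 S) :
    Integrable (fun p => potential g ((u t).toL2 p) - potential g ((u 0).toL2 p)) ∧
    IntervalIntegrable (fun s => (∫ p, nonlinearity g ((u s).toL2 p) * conj (ut s p)).re)
      volume 0 t ∧
    ∫ p, (potential g ((u t).toL2 p) - potential g ((u 0).toL2 p))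
      = ∫ s in (0 : ℝ)..t, (∫ p, nonlinearity g ((u s).toL2 p) * conj (ut s p)).re := by
  have hsub : Icc 0 t ⊆ Icc 0 S := Icc_subset_Icc_right ht.2.le
  have hκ : IntervalIntegrable (fun s => K s * ‖Ut s‖) volume 0 t := by
    rw [intervalIntegrable_iff_integrableOn_Icc_of_le ht.1]
    have : Integrable (fun s => K s * ‖Ut s‖) (volume.restrict (Icc 0 S)) :=
      d.memLp_K.integrable_mul d.memLp_Ut.norm
    exact IntegrableOn.mono_set this hsub
  refine integral_potential_sub_eq_integral hg (u := fun s => (u s).toL2) ht.1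
    (d.cont_toL2.mono hsub) (d.cont_ut.mono hsub)
    (fun s hs => d.hasDerivAt_toL2 ⟨hs.1, hs.2.trans ht.2⟩) hκ ?_
  filter_upwards [(ae_restrict_iff' measurableSet_Icc).1 d.nonlinear_bound,
    (ae_restrict_iff' measurableSet_Icc).1 d.Ut_toL2] with s h1 h2 hs
  have hs' : s ∈ Icc 0 S := hsub (Ioc_subset_Icc_self hs)
  obtain ⟨h3, h4⟩ := h1 hs' (Ut s).conjugate
  have hc := integral_mul_conj_congr (g := g) (u s).toL2 (Ut s).conjugate.toL2 (ut s)
    (by rw [HeisH1.toL2_conjugate, h2 hs'])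
  refine ⟨h3.congr hc, ?_⟩
  rw [HeisH1.norm_conjugate] at h4
  refine (integral_congr_ae ?_).trans_le h4
  filter_upwards [hc] with p hp
  rw [hp]

/-- The energy identity. -/
theorem energy_identity (hg : ContDiffOn ℝ 1 g (Ici 0))
    (hF₀ : Integrable (fun p => potential g (u₀.toL2 p))) {t : ℝ} (ht : t ∈ Ico 0 S) :
    Integrable (fun p => potential g ((u t).toL2 p)) ∧
    1 / 2 * ‖ut t‖ ^ 2 + m / 2 * ‖(u t).toL2‖ ^ 2 + 1 / 2 * ∑ j, ‖(u t).grad j‖ ^ 2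
      - (∫ p, potential g ((u t).toL2 p)) + b * (∫ s in (0 : ℝ)..t, ‖ut s‖ ^ 2)
      = initialEnergy m g u₀ u₁ := by
  obtain ⟨p1, p2, p3⟩ := d.potential_integral hg ht
  rw [d.init] at p1 p3
  -- Integrability of F(u(t)) propagates from F(u₀) through the integrable difference supplied by
  -- the chain rule.
  have hFt : Integrable (fun p => potential g ((u t).toL2 p)) := by
    refine (p1.add hF₀).congr (Eventually.of_forall fun p => ?_)
    simp
  refine ⟨hFt, ?_⟩
  rw [integral_sub hFt hF₀] at p3
  obtain ⟨i1, e1⟩ := d.norm_sq_ut_sub ht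
  obtain ⟨i2, e2⟩ := d.norm_sq_toL2_sub ht
  obtain ⟨i3, e3⟩ := d.norm_sq_sub ht
  have i4 : IntervalIntegrable (fun s => ‖ut s‖ ^ 2) volume 0 t :=
    ((d.cont_ut.norm.pow 2).mono (Icc_subset_Icc_right ht.2.le)).intervalIntegrable_of_Icc ht.1
  have hsum : ∫ s in (0 : ℝ)..t, ((utt s (Ut s).conjugate).re + (inner ℂ (Ut s) (u s)).re
      + (m - 1) * (inner ℂ (ut s) (u s).toL2).re + b * ‖ut s‖ ^ 2)
      = ∫ s in (0 : ℝ)..t, (∫ p, nonlinearity g ((u s).toL2 p) * conj (ut s p)).re := by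
    refine intervalIntegral.integral_congr_ae ?_
    filter_upwards [(ae_restrict_iff' measurableSet_Icc).1 d.equation_velocity] with s hs hst
    rw [uIoc_of_le ht.1] at hst
    exact hs ⟨hst.1.le, hst.2.trans ht.2.le⟩
  rw [intervalIntegral.integral_add ((i1.add i3).add (i2.const_mul _)) (i4.const_mul _),
    intervalIntegral.integral_add (i1.add i3) (i2.const_mul _),
    intervalIntegral.integral_add i1 i3, intervalIntegral.integral_const_mul,
    intervalIntegral.integral_const_mul, ← p3] at hsum
  rw [HeisH1.norm_sq_eq, HeisH1.norm_sq_eq, d.init] at e3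
  rw [d.init] at e2
  rw [initialEnergy]
  linear_combination hsum + (1 / 2) * e1 + (1 / 2) * e3 + (m - 1) / 2 * e2

/-- The lower bound for the growth of `2 Re (u, u_t) + b ‖u‖²`. -/
theorem increment_ge (hg : ContDiffOn ℝ 1 g (Ici 0)) {α : ℝ}
    (hF : ∀ z : ℂ, α * potential g z ≤ (nonlinearity g z * conj z).re)
    (hF₀ : Integrable (fun p => potential g (u₀.toL2 p))) (hα : 2 < α) {s t : ℝ} (hs : 0 ≤ s)
    (hst : s ≤ t) (ht : t < S) :
    (∫ σ in s..t, ((α + 2) * ‖ut σ‖ ^ 2 + (α - 2) * m * ‖(u σ).toL2‖ ^ 2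
      - 2 * α * initialEnergy m g u₀ u₁ + 2 * α * b * ∫ τ in (0 : ℝ)..σ, ‖ut τ‖ ^ 2))
      ≤ 2 * (inner ℂ (u t).toL2 (ut t)).re + b * ‖(u t).toL2‖ ^ 2
        - (2 * (inner ℂ (u s).toL2 (ut s)).re + b * ‖(u s).toL2‖ ^ 2) := by
  have ht' : t ∈ Ico 0 S := ⟨hs.trans hst, ht⟩
  have hs' : s ∈ Ico 0 S := ⟨hs, hst.trans_lt ht⟩
  obtain ⟨i1, e1⟩ := d.re_inner_sub ht'
  obtain ⟨j1, f1⟩ := d.re_inner_sub hs'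
  obtain ⟨i2, e2⟩ := d.norm_sq_toL2_sub ht'
  obtain ⟨j2, f2⟩ := d.norm_sq_toL2_sub hs'
  have k1 := intervalIntegral.integral_interval_sub_left i1 j1
  have k2 := intervalIntegral.integral_interval_sub_left i2 j2
  have l1 := j1.symm.trans i1
  have l2 := j2.symm.trans i2
  have hrhs : 2 * (inner ℂ (u t).toL2 (ut t)).re + b * ‖(u t).toL2‖ ^ 2
        - (2 * (inner ℂ (u s).toL2 (ut s)).re + b * ‖(u s).toL2‖ ^ 2)
      = ∫ σ in s..t, (2 * ((utt σ (u σ).conjugate).re + ‖ut σ‖ ^ 2)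
        + 2 * b * (inner ℂ (ut σ) (u σ).toL2).re) := by
    rw [intervalIntegral.integral_add (l1.const_mul _) (l2.const_mul _),
      intervalIntegral.integral_const_mul, intervalIntegral.integral_const_mul, ← k1, ← k2]
    linear_combination 2 * e1 - 2 * f1 + b * e2 - b * f2
  rw [hrhs]
  have hsub : Icc s t ⊆ Icc 0 S := Icc_subset_Icc hs ht.le
  have hv : ContinuousOn (fun σ => ‖ut σ‖ ^ 2) (Icc 0 S) := d.cont_ut.norm.pow 2
  have hM : ContinuousOn (fun σ => ‖(u σ).toL2‖ ^ 2) (Icc 0 S) := d.cont_toL2.norm.pow 2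
  have hprim : ContinuousOn (fun σ => ∫ τ in (0 : ℝ)..σ, ‖ut τ‖ ^ 2) (Ico 0 S) :=
    EnergyDynamics.continuousOn_primitive (hv.mono Ico_subset_Icc_self)
  have hsub' : Icc s t ⊆ Ico 0 S := fun x hx => ⟨hs.trans hx.1, hx.2.trans_lt ht⟩
  refine intervalIntegral.integral_mono_ae_restrict hst ?_
    ((l1.const_mul 2).add (l2.const_mul (2 * b))) ?_
  · refine ContinuousOn.intervalIntegrable_of_Icc hst ?_
    exact (((continuousOn_const.mul (hv.mono hsub)).add
      (continuousOn_const.mul (hM.mono hsub))).sub continuousOn_const).add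
      (continuousOn_const.mul (hprim.mono hsub'))
  · rw [EventuallyLE, ae_restrict_iff' measurableSet_Icc]
    filter_upwards [(ae_restrict_iff' measurableSet_Icc).1 d.equation_self,
      (ae_restrict_iff' measurableSet_Icc).1 d.nonlinear_bound] with σ q1 q2 hσ
    have hσS := hsub hσ
    obtain ⟨hFσ, en⟩ := d.energy_identity hg hF₀ (hsub' hσ)
    have hint : Integrable (fun p => nonlinearity g ((u σ).toL2 p) * conj ((u σ).toL2 p)) :=
      (q2 hσS (u σ).conjugate).1.congr (integral_mul_conj_congr (g := g) (u σ).toL2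
        (u σ).conjugate.toL2 (u σ).toL2 (HeisH1.toL2_conjugate _))
    have hle : α * (∫ p, potential g ((u σ).toL2 p))
        ≤ (∫ p, nonlinearity g ((u σ).toL2 p) * conj ((u σ).toL2 p)).re := by
      rw [← RCLike.re_to_complex, ← integral_re hint, ← integral_const_mul]
      exact integral_mono (hFσ.const_mul α) hint.re fun p => hF _
    have q := q1 hσS
    -- Eliminating ∫F leaves the gradient with coefficient α − 2 > 0, and this term is dropped.
    have hgrad : 0 ≤ (α - 2) * ∑ j, ‖(u σ).grad j‖ ^ 2 :=
      mul_nonneg (by linarith) (Finset.sum_nonneg fun _ _ => sq_nonneg _)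
    have en2 : α * (∫ p, potential g ((u σ).toL2 p)) = α * (1 / 2 * ‖ut σ‖ ^ 2
        + m / 2 * ‖(u σ).toL2‖ ^ 2 + 1 / 2 * ∑ j, ‖(u σ).grad j‖ ^ 2
        + b * (∫ s in (0 : ℝ)..σ, ‖ut s‖ ^ 2) - initialEnergy m g u₀ u₁) := by
      rw [← en]; ring
    nlinarith

end WeakSolutionData

/-- The time derivative in `L²`. -/
noncomputable def velocity (u : ℝ → HeisH1 n) (t : ℝ) : HeisL2 n :=
  derivWithin (fun s => (u s).toL2) (Ici 0) t

/-- The derivative `ut` is chosen anew for each S; this identifies all choices with one function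
independent of S. -/
theorem WeakSolutionData.velocity_eq {b m : ℝ} {g : ℝ → ℝ} {u₀ : HeisH1 n} {u₁ : HeisL2 n}
    {u : ℝ → HeisH1 n} {S : ℝ} {ut : ℝ → HeisL2 n} {Ut : ℝ → HeisH1 n} {utt : ℝ → HeisHneg1 n}
    {K : ℝ → ℝ} (d : WeakSolutionData b m g u₀ u₁ u S ut Ut utt K) {t : ℝ} (ht : t ∈ Ico 0 S) :
    velocity u t = ut t := by
  refine HasDerivWithinAt.derivWithin ?_ (uniqueDiffOn_Ici 0 t ht.1)
  refine (d.deriv t ⟨ht.1, ht.2.le⟩).mono_of_mem_nhdsWithin ?_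
  filter_upwards [self_mem_nhdsWithin, mem_nhdsWithin_of_mem_nhds (gt_mem_nhds ht.2)] with x h1 h2
  exact ⟨h1, h2.le⟩

theorem IsWeakSolution.energyDynamics {b m α : ℝ} {g : ℝ → ℝ} {u₀ : HeisH1 n} {u₁ : HeisL2 n}
    {u : ℝ → HeisH1 n} {T' : EReal} (hu : IsWeakSolution b m g u₀ u₁ u T')
    (hg : ContDiffOn ℝ 1 g (Ici 0))
    (hF : ∀ z : ℂ, α * potential g z ≤ (nonlinearity g z * conj z).re)
    (hF₀ : Integrable (fun p => potential g (u₀.toL2 p))) (hα : 2 < α)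
    {T : ℝ} (hT : (T : EReal) ≤ T') :
    EnergyDynamics b m α (initialEnergy m g u₀ u₁) (fun t => ‖(u t).toL2‖ ^ 2)
      (fun t => (inner ℂ (u t).toL2 (velocity u t)).re) (fun t => ‖velocity u t‖ ^ 2) T := by
  have get : ∀ t ∈ Ico 0 T, ∃ S, t < S ∧ S < T ∧ ∃ ut Ut utt K,
      WeakSolutionData b m g u₀ u₁ u S ut Ut utt K := by
    intro t ht
    obtain ⟨S, h1, h2⟩ := exists_between ht.2
    exact ⟨S, h1, h2, (hu.2 S (ht.1.trans_lt h1)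
      ((EReal.coe_lt_coe_iff.2 h2).trans_le hT)).exists_data⟩
  have near : ∀ {t S : ℝ}, t < S → S < T → Icc 0 S ∈ 𝓝[Ico 0 T] t := by
    intro t S h1 _
    filter_upwards [self_mem_nhdsWithin, mem_nhdsWithin_of_mem_nhds (gt_mem_nhds h1)] with x h3 h4
    exact ⟨h3.1, h4.le⟩
  have cu : ContinuousOn (fun t => (u t).toL2) (Ico 0 T) := by
    intro t ht
    obtain ⟨S, h1, h2, ut, Ut, utt, K, d⟩ := get t ht
    exact (d.cont_toL2 t ⟨ht.1, h1.le⟩).mono_of_mem_nhdsWithin (near h1 h2)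
  have cv : ContinuousOn (velocity u) (Ico 0 T) := by
    intro t ht
    obtain ⟨S, h1, h2, ut, Ut, utt, K, d⟩ := get t ht
    refine ((d.cont_ut t ⟨ht.1, h1.le⟩).mono_of_mem_nhdsWithin (near h1 h2)).congr_of_eventuallyEq
      ?_ (d.velocity_eq ⟨ht.1, h1⟩)
    filter_upwards [self_mem_nhdsWithin, mem_nhdsWithin_of_mem_nhds (gt_mem_nhds h1)] with x h3 h4
    exact d.velocity_eq ⟨h3.1, h4⟩
  refine ⟨cu.norm.pow 2, Complex.continuous_re.comp_continuousOn (cu.inner cv), cv.norm.pow 2,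
    fun t ht => ?_, fun t => sq_nonneg _, fun t => sq_nonneg _, fun t x => ?_,
    fun s t hs hst htT => ?_⟩
  · obtain ⟨S, h1, h2, ut, Ut, utt, K, d⟩ := get t ⟨ht.1.le, ht.2⟩
    have hd := d.hasDerivAt_toL2 ⟨ht.1, h1⟩
    have h3 := Complex.reCLM.hasFDerivAt.comp_hasDerivAt t (hd.inner ℂ hd)
    have e : (fun t => ‖(u t).toL2‖ ^ 2) =
        Complex.reCLM ∘ fun t => inner ℂ (u t).toL2 (u t).toL2 := by
      funext x
      exact (inner_self_eq_norm_sq (𝕜 := ℂ) (u x).toL2).symm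
    rw [e, d.velocity_eq ⟨ht.1.le, h1⟩]
    refine h3.congr_deriv ?_
    rw [Complex.reCLM_apply, Complex.add_re, re_inner_comm (ut t)]
    ring
  · have h1 : ‖(x : ℂ) • (u t).toL2 + velocity u t‖ ^ 2
        = x ^ 2 * ‖(u t).toL2‖ ^ 2 + 2 * (x * (inner ℂ (u t).toL2 (velocity u t)).re)
          + ‖velocity u t‖ ^ 2 := by
      rw [norm_add_sq (𝕜 := ℂ), norm_smul, inner_smul_left, Complex.conj_ofReal,
        RCLike.re_to_complex, Complex.re_ofReal_mul, mul_pow, Complex.norm_real, Real.norm_eq_abs,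
        sq_abs]
    have h2 := sq_nonneg ‖(x : ℂ) • (u t).toL2 + velocity u t‖
    rw [h1] at h2
    linarith
  · obtain ⟨S, h1, h2, ut, Ut, utt, K, d⟩ := get t ⟨hs.trans hst, htT⟩
    have hv : ∀ x ∈ Icc 0 t, velocity u x = ut x := fun x hx =>
      d.velocity_eq ⟨hx.1, hx.2.trans_lt h1⟩
    have key := d.increment_ge hg hF hF₀ hα hs hst h1
    rw [← hv t ⟨hs.trans hst, le_rfl⟩, ← hv s ⟨hs, hst⟩] at key
    refine le_of_eq_of_le (intervalIntegral.integral_congr fun σ hσ => ?_) key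
    rw [uIcc_of_le hst] at hσ
    have e : ∫ τ in (0 : ℝ)..σ, ‖velocity u τ‖ ^ 2 = ∫ τ in (0 : ℝ)..σ, ‖ut τ‖ ^ 2 := by
      refine intervalIntegral.integral_congr fun τ hτ => ?_
      rw [uIcc_of_le (hs.trans hσ.1)] at hτ
      simp only [hv τ ⟨hτ.1, hτ.2.trans hσ.2⟩]
    simp only [e, hv σ ⟨hs.trans hσ.1, hσ.2⟩]

theorem IsWeakSolution.init {b m : ℝ} {g : ℝ → ℝ} {u₀ : HeisH1 n} {u₁ : HeisL2 n}
    {u : ℝ → HeisH1 n} {T : EReal} (hu : IsWeakSolution b m g u₀ u₁ u T) :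
    u 0 = u₀ ∧ velocity u 0 = u₁ := by
  obtain ⟨S, h1, h2⟩ := EReal.lt_iff_exists_real_btwn.1 hu.1
  have hS : 0 < S := by exact_mod_cast h1
  obtain ⟨ut, Ut, utt, K, d⟩ := (hu.2 S hS h2).exists_data
  exact ⟨d.init, (d.velocity_eq ⟨le_rfl, hS⟩).trans d.init_ut⟩

theorem toL2_ne_zero_of_nehari_neg {m : ℝ} {g : ℝ → ℝ} {u₀ : HeisH1 n} (hm : 0 < m)
    (h : nehari m g u₀ < 0) : 0 < ‖u₀.toL2‖ ^ 2 := by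
  rcases eq_or_ne u₀.toL2 0 with h0 | h0
  · exfalso
    have hi : ∫ p, nonlinearity g (u₀.toL2 p) * conj (u₀.toL2 p) = 0 := by
      refine integral_eq_zero_of_ae ?_
      filter_upwards [Lp.eq_zero_iff_ae_eq_zero.1 h0] with p hp
      simp [hp]
    rw [nehari, hi] at h
    have h1 : 0 ≤ m * ‖u₀.toL2‖ ^ 2 := by positivity
    have h2 : 0 ≤ ∑ j, ‖u₀.grad j‖ ^ 2 := Finset.sum_nonneg fun _ _ => sq_nonneg _
    simp only [Complex.zero_re, sub_zero] at h
    linarith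
  · positivity

end WeakSolutions

/-! ### Maximal continuation -/

section Continuation

variable {n : ℕ} {b m : ℝ} {g : ℝ → ℝ} {u₀ : HeisH1 n} {u₁ : HeisL2 n}

theorem IsWeakSolutionOn.congr {u w : ℝ → HeisH1 n} {S : ℝ}
    (h : IsWeakSolutionOn b m g u₀ u₁ u S) (hS : 0 ≤ S) (he : ∀ t ∈ Icc 0 S, w t = u t) :
    IsWeakSolutionOn b m g u₀ u₁ w S := by
  obtain ⟨h1, h2, ut, Ut, utt, K, h3, h4, h5, h6, h7, h8, h9, h10, h11, h12⟩ := h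
  refine ⟨h1.congr he, (he 0 ⟨le_rfl, hS⟩).trans h2, ut, Ut, utt, K, fun t ht => ?_, h4, h5, h6,
    h7, h8, h9, h10, ?_, ?_⟩
  · exact (h3 t ht).congr (fun s hs => by rw [he s hs]) (by rw [he t ht])
  · filter_upwards [h11, ae_restrict_mem measurableSet_Icc] with t h ht
    rw [he t ht]
    exact h
  · filter_upwards [h12, ae_restrict_mem measurableSet_Icc] with t h ht
    rw [he t ht]
    exact h

/-- Every weak solution has a maximal continuation. -/
theorem IsWeakSolution.exists_maximal {u : ℝ → HeisH1 n} {T₁ : EReal}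
    (hu : IsWeakSolution b m g u₀ u₁ u T₁) :
    ∃ (T : EReal) (w : ℝ → HeisH1 n), T₁ ≤ T ∧ IsWeakSolution b m g u₀ u₁ w T ∧
      (∀ t : ℝ, 0 ≤ t → (t : EReal) < T₁ → w t = u t) ∧
      ∀ (T' : EReal) (w' : ℝ → HeisH1 n), T < T' → IsWeakSolution b m g u₀ u₁ w' T' →
        ¬ ∀ t : ℝ, 0 ≤ t → (t : EReal) < T → w' t = w t := by
  let X := {x : EReal × (ℝ → HeisH1 n) // T₁ ≤ x.1 ∧ IsWeakSolution b m g u₀ u₁ x.2 x.1 ∧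
    ∀ t : ℝ, 0 ≤ t → (t : EReal) < T₁ → x.2 t = u t}
  -- Extension is only a preorder, since values beyond the lifespan are arbitrary; Zorn's lemma in
  -- its preorder form suffices.
  let R : X → X → Prop := fun x y => x.1.1 ≤ y.1.1 ∧
    ∀ t : ℝ, 0 ≤ t → (t : EReal) < x.1.1 → y.1.2 t = x.1.2 t
  have trans : ∀ {x y z : X}, R x y → R y z → R x z := fun hxy hyz =>
    ⟨hxy.1.trans hyz.1, fun t h0 ht => (hyz.2 t h0 (ht.trans_le hxy.1)).trans (hxy.2 t h0 ht)⟩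
  have bdd : ∀ c : Set X, IsChain R c → ∃ ub, ∀ a ∈ c, R a ub := by
    intro c hc
    rcases c.eq_empty_or_nonempty with rfl | ⟨x₀, hx₀⟩
    · exact ⟨⟨(T₁, u), le_rfl, hu, fun _ _ _ => rfl⟩, by simp⟩
    classical
    set T : EReal := sSup ((fun x : X => x.1.1) '' c) with hT
    have hle : ∀ x ∈ c, x.1.1 ≤ T := fun x hx => le_sSup ⟨x, hx, rfl⟩
    have hlt : ∀ t : EReal, t < T → ∃ x ∈ c, t < x.1.1 := by
      intro t ht
      obtain ⟨_, ⟨x, hx, rfl⟩, hxt⟩ := lt_sSup_iff.1 ht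
      exact ⟨x, hx, hxt⟩
    -- The chain is glued by using at t any member alive at t. Members agree by the chain condition,
    -- and each [0, S] below the supremum lies in the lifespan of a single member.
    let W : ℝ → HeisH1 n := fun t =>
      if h : ∃ x ∈ c, (t : EReal) < x.1.1 then h.choose.1.2 t else 0
    have hW : ∀ x ∈ c, ∀ t : ℝ, 0 ≤ t → (t : EReal) < x.1.1 → W t = x.1.2 t := by
      intro x hx t h0 ht
      have h : ∃ x ∈ c, (t : EReal) < x.1.1 := ⟨x, hx, ht⟩
      have e : W t = h.choose.1.2 t := dif_pos h
      rw [e]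
      by_cases hxy : h.choose = x
      · rw [hxy]
      rcases hc h.choose_spec.1 hx hxy with hr | hr
      · exact (hr.2 t h0 h.choose_spec.2).symm
      · exact hr.2 t h0 ht
    have h₁T : T₁ ≤ T := x₀.2.1.trans (hle x₀ hx₀)
    refine ⟨⟨(T, W), h₁T, ⟨hu.1.trans_le h₁T, fun S hS hST => ?_⟩, fun t h0 ht => ?_⟩,
      fun x hx => ⟨hle x hx, hW x hx⟩⟩
    · obtain ⟨x, hx, hSx⟩ := hlt S hST
      refine (x.2.2.1.2 S hS hSx).congr hS.le fun t ht => hW x hx t ht.1 ?_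
      exact (EReal.coe_le_coe_iff.2 ht.2).trans_lt hSx
    · exact (hW x₀ hx₀ t h0 (ht.trans_le x₀.2.1)).trans (x₀.2.2.2 t h0 ht)
  obtain ⟨x, hx⟩ := exists_maximal_of_chains_bounded (r := R) bdd trans
  refine ⟨x.1.1, x.1.2, x.2.1, x.2.2.1, x.2.2.2, fun T' w' hT hw' he => ?_⟩
  have := (hx ⟨(T', w'), x.2.1.trans hT.le, hw', fun t h0 ht =>
    (he t h0 (ht.trans_le x.2.1)).trans (x.2.2.2 t h0 ht)⟩ ⟨hT.le, he⟩).1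
  exact absurd hT (not_lt.2 this)

end Continuation

/-! ### The blow-up theorem -/

theorem theorem2p1 (n : ℕ) (b m α μ : ℝ) (hb : 0 < b) (hm : 0 < m) (hα : 2 < α)
    (hμ : μ = max b (max m α))
    (g : ℝ → ℝ) (hg : ContDiffOn ℝ 1 g (Ici 0))
    (hF : ∀ z : ℂ, α * potential g z ≤ (nonlinearity g z * conj z).re)
    (u₀ : HeisH1 n) (u₁ : HeisL2 n)
    (hF₀ : Integrable (fun p => potential g (u₀.toL2 p)))
    (hI : nehari m g u₀ < 0)
    (hE : α * (μ + 1) / (m * (α - 2)) * initialEnergy m g u₀ u₁ ≤ (inner ℂ u₀.toL2 u₁).re)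
    (u : ℝ → HeisH1 n) (T₁ : EReal) (hu : IsWeakSolution b m g u₀ u₁ u T₁) :
    ∃ Tstar : ℝ, 0 < Tstar ∧ T₁ ≤ Tstar ∧
      (∃ w : ℝ → HeisH1 n, (∀ t : ℝ, 0 ≤ t → (t : EReal) < T₁ → w t = u t) ∧
        BlowsUpAt b m g u₀ u₁ w Tstar) ∧
      (0 < (inner ℂ u₀.toL2 u₁).re → ∀ T₀ : ℝ, Tstar < T₀ →
        Tstar ≤ 2 * (μ + 1) * (b * T₀ + 1) / ((α - 2) * (μ + 1 - m))
          * (‖u₀.toL2‖ ^ 2 / (inner ℂ u₀.toL2 u₁).re)) := by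
  have hbμ : b ≤ μ := hμ ▸ le_max_left _ _
  have hmμ : m ≤ μ := hμ ▸ (le_max_left _ _).trans (le_max_right _ _)
  obtain ⟨T, w, hT₁, hw, hwu, hmax⟩ := hu.exists_maximal
  obtain ⟨w0, v0⟩ := hw.init
  have hM0 : 0 < ‖(w 0).toL2‖ ^ 2 := by
    rw [w0]
    exact toL2_ne_zero_of_nehari_neg hm hI
  have he : α * (μ + 1) / (m * (α - 2)) * initialEnergy m g u₀ u₁
      ≤ (inner ℂ (w 0).toL2 (velocity w 0)).re := by rwa [w0, v0]
  induction T using EReal.rec with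
  | bot => exact absurd hw.1 (not_lt.2 bot_le)
  | top =>
    exact (EnergyDynamics.not_global hb hm hα hbμ hmμ
      (fun T _ => hw.energyDynamics hg hF hF₀ hα (T := T) le_top) hM0 he).elim
  | coe T =>
    have hT : 0 < T := by exact_mod_cast hw.1
    refine ⟨T, hT, hT₁, ⟨w, hwu, hw, ?_⟩, fun hr T₀ hT₀ => ?_⟩
    · rintro ⟨T', w', hTT', hw', he'⟩
      exact hmax T' w' hTT' hw' fun t h0 ht => he' t h0 (EReal.coe_lt_coe_iff.1 ht)
    · have := (hw.energyDynamics hg hF hF₀ hα le_rfl).lifespan_le hb hm hα hbμ hmμ hT hM0 he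
        (by rwa [w0, v0]) hT₀.le
      simpa only [w0, v0] using this
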